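/- Let $k\ge 2$ be an integer, $\Gamma=\mathrm{SL}_2(\mathbb Z)$, $T=\begin{pmatrix}1&1\\0&1\end{pmatrix}$, $q=e^{2\pi i z}$ and $D=\frac1{2\pi i}\frac{d}{dz}$. For an integer $w$ let $M_w^!$ be the space of weakly holomorphic modular forms of weight $w$ for $\Gamma$ (holomorphic on the upper half-plane $\mathfrak H$, modular of weight $w$, with a Fourier expansion $f=\sum_{n\ge -N}a_nq^n$), let $S_w^!$ be its subspace given by $a_0=0$, and let $M_{w,\mathbb Q}^!$, $S_{w,\mathbb Q}^!$ be the $\mathbb Q$-subspaces of forms with rational Fourier coefficients. For $K=\mathbb Q$ or $\mathbb C$ let $P_{k-2}(K)$ be the space of polynomials of degree $\le k-2$ over $K$, with the right $\Gamma$-action $(P\|\gamma)(z)=(cz+d)^{k-2}P(\gamma z)$, $\gamma=\begin{pmatrix}*&*\\c&d\end{pmatrix}$. Put $(d^0v)(\gamma)=v\|\gamma-v$, let $Z^1(\Gamma,P_{k-2}(K))$ be the space of maps $\sigma:\Gamma\to P_{k-2}(K)$ with $\sigma(g_2g_1)=\sigma(g_2)\|g_1+\sigma(g_1)$, let $B^1$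 be the image of $d^0$ on $P_{k-2}(K)$, and let $Z^1_{\mathrm{par}}$, $B^1_{\mathrm{par}}$ be the subspaces of $Z^1$, $B^1$ given by $\sigma(T)=0$. Set $H^1=Z^1/B^1$ and $H^1_{\mathrm{par}}=Z^1_{\mathrm{par}}/B^1_{\mathrm{par}}$. For $f\in M_k^!$ put $$\phi(f)(\gamma)(z)=\int_i^{\gamma^{-1}i}f(w)(w-z)^{k-2}\,dw .$$ For $f=\sum a_nq^n\in S_k^!$ put $\tilde f=\sum_{n>0}a_nq^n$, $\mathring f=\sum_{n<0}a_nq^n$ (a finite sum, hence an entire function) and $$v'_f(z)=\int_z^{i\infty}\tilde f(w)(w-z)^{k-2}\,dw+\int_z^{-i\infty}\mathring f(w)(w-z)^{k-2}\,dw\quad(z\in\mathfrak H),\qquad \phi'(f)=d^0v'_f ,$$ with integration along vertical half-lines. Then $D^{k-1}M_{2-k}^!\subseteq S_k^!$ and $D^{k-1}M_{2-k,\mathbb Q}^!\subseteq S_{k,\mathbb Q}^!$, and the following hold. (a) For $f\in M_k^!$ the map $\phi(f)$ is a cocycle with values in $P_{k-2}(\mathbb C)$, and for $f\in S_k^!$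 the map $\phi'(f)$ is a parabolic cocycle with values in $P_{k-2}(\mathbb C)$. They induce $\mathbb C$-linear maps $[\phi]$, $[\phi']$, and the square $$\begin{array}{ccc} M_k^!/D^{k-1}M_{2-k}^! & \xrightarrow{\ [\phi]\ } & H^1(\Gamma,P_{k-2}(\mathbb C))\\ {\scriptstyle i}\uparrow & & \uparrow{\scriptstyle j}\\ S_k^!/D^{k-1}M_{2-k}^! & \xrightarrow{\ [\phi']\ } & H^1_{\mathrm{par}}(\Gamma,P_{k-2}(\mathbb C))\end{array}$$ in which $i$, $j$ are the natural maps, which are injective, commutes: $j\circ[\phi']=[\phi]\circ i$. (b) The natural maps $H^1(\Gamma,P_{k-2}(\mathbb Q))\otimes_{\mathbb Q}\mathbb C\to H^1(\Gamma,P_{k-2}(\mathbb C))$ and $H^1_{\mathrm{par}}(\Gamma,P_{k-2}(\mathbb Q))\otimes_{\mathbb Q}\mathbb C\to H^1_{\mathrm{par}}(\Gamma,P_{k-2}(\mathbb C))$ are bijective. With these identifications $\phi$ and $\phi'$ induce $\mathbb C$-linear maps $$[\phi]:\bigl(M_{k,\mathbb Q}^!/D^{k-1}M_{2-k,\mathbb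 Q}^!\bigr)\otimes_{\mathbb Q}\mathbb C\to H^1(\Gamma,P_{k-2}(\mathbb Q))\otimes_{\mathbb Q}\mathbb C,\qquad [\phi']:\bigl(S_{k,\mathbb Q}^!/D^{k-1}M_{2-k,\mathbb Q}^!\bigr)\otimes_{\mathbb Q}\mathbb C\to H^1_{\mathrm{par}}(\Gamma,P_{k-2}(\mathbb Q))\otimes_{\mathbb Q}\mathbb C,$$ the natural maps $i\otimes\mathbb C$, $j\otimes\mathbb C$ are injective, and $(j\otimes\mathbb C)\circ[\phi']=[\phi]\circ(i\otimes\mathbb C)$. -/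

import Mathlib

open Complex UpperHalfPlane MeasureTheory
open scoped Manifold MatrixGroups TensorProduct

noncomputable section

/-! ### Weakly holomorphic modular forms for `Γ = SL(2, ℤ)` -/

/-- `e n z = q ^ n` with `q = exp (2 π i z)`. -/
def qPow (n : ℤ) (z : ℂ) : ℂ := Complex.exp (2 * Real.pi * Complex.I * n * z)

/-- The `n`-th Fourier coefficient `∫₀¹ f(x + i) q^{-n} dx` (with `q = exp (2 π i (x + i))`)
of a continuous `1`-periodic function on the upper half-plane. For a function that is the sum of a
Fourier series `∑ aₙ qⁿ`, this is `aₙ`. -/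
def fourierCoef (f : ℍ → ℂ) (n : ℤ) : ℂ :=
  ∫ x in (0 : ℝ)..1, (f ∘ ofComplex) (x + Complex.I) * qPow (-n) (x + Complex.I)

/-- Weakly holomorphic modular forms of weight `w` for `SL(2, ℤ)`: holomorphic on the upper
half-plane, modular of weight `w`, and meromorphic at the cusp, i.e. `f` is the sum of a Fourier
series `∑_{n ≥ -N} aₙ qⁿ` with only finitely many terms of negative index. -/
structure IsWeaklyHolomorphic (w : ℤ) (f : ℍ → ℂ) : Prop where
  mdiff : MDiff f
  modular : ∀ (γ : SL(2, ℤ)) (z : ℍ), f (γ • z) = ((γ 1 0 : ℂ) * z + γ 1 1) ^ w * f z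
  principal : ∃ N : ℕ, ∀ n : ℤ, n < -(N : ℤ) → fourierCoef f n = 0
  hasSum : ∀ z : ℍ, HasSum (fun n : ℤ => fourierCoef f n * qPow n z) (f z)

lemma fourierCoef_intervalIntegrable {f : ℍ → ℂ} (hf : MDiff f) (n : ℤ) :
    IntervalIntegrable
      (fun x : ℝ => (f ∘ ofComplex) (x + Complex.I) * qPow (-n) (x + Complex.I)) volume 0 1 := by
  apply Continuous.intervalIntegrable
  have h1 : ContinuousOn (f ∘ ofComplex) {z | 0 < z.im} :=
    (UpperHalfPlane.mdifferentiable_iff.mp hf).continuousOn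
  have h2 : Continuous fun x : ℝ => (f ∘ ofComplex) (x + Complex.I) :=
    h1.comp_continuous (by fun_prop) (by intro x; simp)
  refine h2.mul ?_
  unfold qPow
  fun_prop

lemma fourierCoef_add {f g : ℍ → ℂ} (hf : MDiff f) (hg : MDiff g) (n : ℤ) :
    fourierCoef (f + g) n = fourierCoef f n + fourierCoef g n := by
  unfold fourierCoef
  rw [← intervalIntegral.integral_add (fourierCoef_intervalIntegrable hf n)
    (fourierCoef_intervalIntegrable hg n)]
  congr 1
  ext x
  simp [add_mul]

lemma fourierCoef_smul (c : ℂ) (f : ℍ → ℂ) (n : ℤ) :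
    fourierCoef (c • f) n = c * fourierCoef f n := by
  unfold fourierCoef
  rw [← intervalIntegral.integral_const_mul]
  congr 1
  ext x
  simp [mul_assoc]

lemma fourierCoef_zero (n : ℤ) : fourierCoef 0 n = 0 := by
  simp [fourierCoef]

lemma IsWeaklyHolomorphic.zero (w : ℤ) : IsWeaklyHolomorphic w 0 where
  mdiff := mdifferentiable_const
  modular := by simp
  principal := ⟨0, fun n _ => fourierCoef_zero n⟩
  hasSum := by intro z; simp [fourierCoef_zero, hasSum_zero]

lemma IsWeaklyHolomorphic.add {w : ℤ} {f g : ℍ → ℂ} (hf : IsWeaklyHolomorphic w f)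
    (hg : IsWeaklyHolomorphic w g) : IsWeaklyHolomorphic w (f + g) where
  mdiff := hf.mdiff.add hg.mdiff
  modular γ z := by
    rw [Pi.add_apply, Pi.add_apply, hf.modular γ z, hg.modular γ z, mul_add]
  principal := by
    obtain ⟨N, hN⟩ := hf.principal
    obtain ⟨M, hM⟩ := hg.principal
    refine ⟨max N M, fun n hn => ?_⟩
    rw [fourierCoef_add hf.mdiff hg.mdiff, hN n (by push_cast at hn; omega),
      hM n (by push_cast at hn; omega), add_zero]
  hasSum z := by
    simpa [fourierCoef_add hf.mdiff hg.mdiff, add_mul] using (hf.hasSum z).add (hg.hasSum z)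

lemma IsWeaklyHolomorphic.smul {w : ℤ} (c : ℂ) {f : ℍ → ℂ} (hf : IsWeaklyHolomorphic w f) :
    IsWeaklyHolomorphic w (c • f) where
  mdiff := hf.mdiff.const_smul c
  modular γ z := by
    rw [Pi.smul_apply, Pi.smul_apply, hf.modular γ z, smul_eq_mul, smul_eq_mul, mul_left_comm]
  principal := by
    obtain ⟨N, hN⟩ := hf.principal
    exact ⟨N, fun n hn => by rw [fourierCoef_smul, hN n hn, mul_zero]⟩
  hasSum z := by
    simpa [fourierCoef_smul, mul_assoc] using (hf.hasSum z).mul_left c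

/-- The `K`-vector space of weakly holomorphic modular forms of weight `w` for `SL(2, ℤ)` all of
whose Fourier coefficients lie in the subfield `K` of `ℂ`. For `K = ℂ` the condition on the
coefficients is empty and this is `M_w^!`; for `K = ℚ` it is `M_{w,ℚ}^!`. -/
def weakForms (K : Type) [Field K] [Algebra K ℂ] (w : ℤ) : Submodule K (ℍ → ℂ) where
  carrier := {f | IsWeaklyHolomorphic w f ∧ ∀ n, fourierCoef f n ∈ Set.range (algebraMap K ℂ)}
  zero_mem' := ⟨.zero w, fun n => ⟨0, by simp [fourierCoef_zero]⟩⟩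
  add_mem' := by
    rintro f g ⟨hf, hf'⟩ ⟨hg, hg'⟩
    refine ⟨hf.add hg, fun n => ?_⟩
    obtain ⟨a, ha⟩ := hf' n
    obtain ⟨b, hb⟩ := hg' n
    exact ⟨a + b, by rw [fourierCoef_add hf.mdiff hg.mdiff, map_add, ha, hb]⟩
  smul_mem' := by
    rintro c f ⟨hf, hf'⟩
    rw [← algebraMap_smul ℂ c f]
    refine ⟨hf.smul _, fun n => ?_⟩
    obtain ⟨a, ha⟩ := hf' n
    exact ⟨c * a, by rw [fourierCoef_smul, map_mul, ha]⟩

/-- The subspace of weakly holomorphic cusp forms: the constant term of the Fourier expansion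
vanishes (`S_w^!` for `K = ℂ`, and `S_{w,ℚ}^!` for `K = ℚ`). -/
def weakCuspForms (K : Type) [Field K] [Algebra K ℂ] (w : ℤ) : Submodule K (ℍ → ℂ) where
  carrier := {f | f ∈ weakForms K w ∧ fourierCoef f 0 = 0}
  zero_mem' := ⟨zero_mem _, fourierCoef_zero 0⟩
  add_mem' := by
    rintro f g ⟨hf, hf'⟩ ⟨hg, hg'⟩
    exact ⟨add_mem hf hg, by rw [fourierCoef_add hf.1.mdiff hg.1.mdiff, hf', hg', add_zero]⟩
  smul_mem' := by
    rintro c f ⟨hf, hf'⟩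
    refine ⟨Submodule.smul_mem _ c hf, ?_⟩
    rw [← algebraMap_smul ℂ c f, fourierCoef_smul, hf', mul_zero]

lemma weakCuspForms_le (K : Type) [Field K] [Algebra K ℂ] (w : ℤ) :
    weakCuspForms K w ≤ weakForms K w := fun _ hf => hf.1

/-- The iterate `D ^ n` of `D = (2 π i)⁻¹ d/dz`. -/
def iterD (n : ℕ) (f : ℍ → ℂ) : ℍ → ℂ := Derivative.normalizedDerivOfComplex^[n] f

lemma iterD_mdiff (n : ℕ) {f : ℍ → ℂ} (hf : MDiff f) : MDiff (iterD n f) := by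
  induction n with
  | zero => exact hf
  | succ n ih =>
    unfold iterD at *
    rw [Function.iterate_succ_apply']
    exact Derivative.normalizedDerivOfComplex_mdifferentiable ih

lemma iterD_add (n : ℕ) {f g : ℍ → ℂ} (hf : MDiff f) (hg : MDiff g) :
    iterD n (f + g) = iterD n f + iterD n g := by
  induction n with
  | zero => rfl
  | succ n ih =>
    have h1 := iterD_mdiff n hf
    have h2 := iterD_mdiff n hg
    unfold iterD at *
    rw [Function.iterate_succ_apply', ih, Derivative.normalizedDerivOfComplex_add _ _ h1 h2,
      Function.iterate_succ_apply', Function.iterate_succ_apply']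

lemma iterD_smul (n : ℕ) (c : ℂ) {f : ℍ → ℂ} (hf : MDiff f) :
    iterD n (c • f) = c • iterD n f := by
  induction n with
  | zero => rfl
  | succ n ih =>
    have h1 := iterD_mdiff n hf
    unfold iterD at *
    rw [Function.iterate_succ_apply', ih, Derivative.normalizedDerivOfComplex_smul _ _ h1,
      Function.iterate_succ_apply']

/-- The space `D^{k-1} M_{2-k}^!` (for `K = ℂ`), resp. `D^{k-1} M_{2-k,ℚ}^!` (for `K = ℚ`). -/
def exactForms (K : Type) [Field K] [Algebra K ℂ] (k : ℕ) : Submodule K (ℍ → ℂ) where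
  carrier := {f | ∃ g ∈ weakForms K (2 - k), f = iterD (k - 1) g}
  zero_mem' := ⟨0, zero_mem _, by
    have := iterD_smul (k - 1) 0 (f := 0) mdifferentiable_const
    simpa using this.symm⟩
  add_mem' := by
    rintro _ _ ⟨f, hf, rfl⟩ ⟨g, hg, rfl⟩
    exact ⟨f + g, add_mem hf hg, (iterD_add _ hf.1.mdiff hg.1.mdiff).symm⟩
  smul_mem' := by
    rintro c _ ⟨f, hf, rfl⟩
    refine ⟨c • f, Submodule.smul_mem _ c hf, ?_⟩
    rw [← algebraMap_smul ℂ c f, iterD_smul _ _ hf.1.mdiff, algebraMap_smul]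

/-- `M_k^! / D^{k-1} M_{2-k}^!`, with Fourier coefficients in `K`. -/
abbrev FormClasses (K : Type) [Field K] [Algebra K ℂ] (k : ℕ) : Type :=
  weakForms K k ⧸ (exactForms K k).submoduleOf (weakForms K k)

/-- `S_k^! / D^{k-1} M_{2-k}^!`, with Fourier coefficients in `K`. -/
abbrev CuspFormClasses (K : Type) [Field K] [Algebra K ℂ] (k : ℕ) : Type :=
  weakCuspForms K k ⧸ (exactForms K k).submoduleOf (weakCuspForms K k)

/-- The class of a form `f` in `M_k^! / D^{k-1} M_{2-k}^!`. -/
def formClass (K : Type) [Field K] [Algebra K ℂ] (k : ℕ) (f : weakForms K k) : FormClasses K k :=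
  Submodule.Quotient.mk f

/-- The class of a cusp form `f` in `S_k^! / D^{k-1} M_{2-k}^!`. -/
def cuspFormClass (K : Type) [Field K] [Algebra K ℂ] (k : ℕ) (f : weakCuspForms K k) :
    CuspFormClasses K k :=
  Submodule.Quotient.mk f

/-- The natural map `i : S_k^! / D^{k-1} M_{2-k}^! → M_k^! / D^{k-1} M_{2-k}^!`, `[f] ↦ [f]`. -/
def natI (K : Type) [Field K] [Algebra K ℂ] (k : ℕ) :
    CuspFormClasses K k →ₗ[K] FormClasses K k :=
  Submodule.mapQ _ _ (Submodule.inclusion (weakCuspForms_le K k)) (fun _ hf => hf)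

/-! ### Eichler cohomology and parabolic cohomology -/

/-- `P_m(K)`: polynomials of degree at most `m` with coefficients in `K`. -/
def PolyLE (K : Type) [Field K] (m : ℕ) : Type := Polynomial.degreeLE K (m : WithBot ℕ)

instance (K : Type) [Field K] (m : ℕ) : AddCommGroup (PolyLE K m) :=
  inferInstanceAs (AddCommGroup (Polynomial.degreeLE K (m : WithBot ℕ)))

instance (R K : Type) [CommSemiring R] [Field K] [Algebra R K] (m : ℕ) : Module R (PolyLE K m) :=
  inferInstanceAs (Module R (Polynomial.degreeLE K (m : WithBot ℕ)))

instance (R K : Type) [CommSemiring R] [Field K] [Algebra R K] (m : ℕ) :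
    IsScalarTower R K (PolyLE K m) :=
  inferInstanceAs (IsScalarTower R K (Polynomial.degreeLE K (m : WithBot ℕ)))

/-- The polynomial underlying an element of `P_m(K)`, as a linear map. -/
def PolyLE.toPoly {K : Type} [Field K] {m : ℕ} : PolyLE K m →ₗ[K] Polynomial K :=
  (Polynomial.degreeLE K (m : WithBot ℕ)).subtype

lemma PolyLE.degree_le {K : Type} [Field K] {m : ℕ} (p : PolyLE K m) :
    p.toPoly.degree ≤ m := Polynomial.mem_degreeLE.mp p.2

lemma PolyLE.toPoly_injective {K : Type} [Field K] {m : ℕ} :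
    Function.Injective (PolyLE.toPoly (K := K) (m := m)) := Subtype.val_injective

lemma PolyLE.toPoly_smul {R K : Type} [CommSemiring R] [Field K] [Algebra R K] {m : ℕ} (c : R)
    (p : PolyLE K m) : (c • p).toPoly = c • p.toPoly := rfl

/-- A polynomial of degree at most `m`, as an element of `P_m(K)`. -/
def PolyLE.ofPoly {K : Type} [Field K] {m : ℕ} (p : Polynomial K) (hp : p.degree ≤ m) :
    PolyLE K m := ⟨p, Polynomial.mem_degreeLE.mpr hp⟩

lemma PolyLE.toPoly_ofPoly {K : Type} [Field K] {m : ℕ} (p : Polynomial K)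
    (hp : p.degree ≤ m) : (PolyLE.ofPoly p hp).toPoly = p := rfl

open Polynomial in
/-- The polynomial `(c X + d)^m p((a X + b) / (c X + d))`, for `p` of degree at most `m`. -/
def slashRaw {K : Type} [Field K] (m : ℕ) (γ : SL(2, ℤ)) (p : K[X]) : K[X] :=
  ∑ i ∈ Finset.range (m + 1), C (p.coeff i) *
    ((C (γ 0 0 : K) * X + C (γ 0 1 : K)) ^ i * (C (γ 1 0 : K) * X + C (γ 1 1 : K)) ^ (m - i))

open Polynomial in
lemma slashRaw_degree_le {K : Type} [Field K] (m : ℕ) (γ : SL(2, ℤ)) (p : K[X]) :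
    (slashRaw m γ p).degree ≤ m := by
  refine degree_le_of_natDegree_le (natDegree_sum_le_of_forall_le _ _ fun i hi => ?_)
  have hi' : i ≤ m := by simpa [Nat.lt_succ_iff] using hi
  have hl : ∀ a b : K, (C a * X + C b).natDegree ≤ 1 := fun a b => natDegree_linear_le
  refine (natDegree_C_mul_le _ _).trans (natDegree_mul_le.trans ?_)
  have h1 := natDegree_pow_le_of_le (p := C (γ 0 0 : K) * X + C (γ 0 1 : K)) i (hl _ _)
  have h2 := natDegree_pow_le_of_le (p := C (γ 1 0 : K) * X + C (γ 1 1 : K)) (m - i) (hl _ _)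
  omega

open Polynomial in
/-- The right action of weights `(-m, 0)` of `SL(2, ℤ)` on `P_m(K)`:
`(P ∥ γ)(z) = (c z + d)^m P((a z + b) / (c z + d))`. -/
def polySlash (K : Type) [Field K] (m : ℕ) (γ : SL(2, ℤ)) : PolyLE K m →ₗ[K] PolyLE K m where
  toFun p := .ofPoly (slashRaw m γ p.toPoly) (slashRaw_degree_le m γ p.toPoly)
  map_add' p q := by
    apply PolyLE.toPoly_injective
    simp [PolyLE.toPoly_ofPoly, slashRaw, add_mul, Finset.sum_add_distrib]
  map_smul' c p := by
    apply PolyLE.toPoly_injective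
    simp [PolyLE.toPoly_ofPoly, slashRaw, Finset.smul_sum, smul_eq_C_mul, mul_assoc]

open Polynomial in
lemma polySlash_toPoly {K : Type} [Field K] (m : ℕ) (γ : SL(2, ℤ)) (p : PolyLE K m) :
    (polySlash K m γ p).toPoly = slashRaw m γ p.toPoly := rfl

open Polynomial in
lemma polySlash_eval {K : Type} [Field K] (m : ℕ) (γ : SL(2, ℤ)) (p : PolyLE K m) (z : K)
    (hz : (γ 1 0 : K) * z + γ 1 1 ≠ 0) :
    (polySlash K m γ p).toPoly.eval z = ((γ 1 0 : K) * z + γ 1 1) ^ m *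
      p.toPoly.eval (((γ 0 0 : K) * z + γ 0 1) / ((γ 1 0 : K) * z + γ 1 1)) := by
  have hp : p.toPoly.natDegree < m + 1 :=
    Nat.lt_succ_of_le (natDegree_le_of_degree_le p.degree_le)
  rw [eval_eq_sum_range' hp, Finset.mul_sum]
  simp only [polySlash_toPoly, slashRaw, eval_finsetSum]
  refine Finset.sum_congr rfl fun i hi => ?_
  have hi' : i ≤ m := by simpa [Nat.lt_succ_iff] using hi
  simp only [eval_mul, eval_C, eval_pow, eval_add, eval_X, div_pow]
  rw [pow_sub₀ _ hz hi']
  field_simp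

/-- The differential `d⁰ : C⁰(Γ, P_m(K)) → C¹(Γ, P_m(K))`, `(d⁰ P)(γ) = P ∥ γ - P`. -/
def dZero (K : Type) [Field K] (m : ℕ) : PolyLE K m →ₗ[K] (SL(2, ℤ) → PolyLE K m) :=
  LinearMap.pi fun γ => polySlash K m γ - LinearMap.id

/-- The differential `d¹ : C¹(Γ, P_m(K)) → C²(Γ, P_m(K))`,
`(d¹ σ)(g₁, g₂) = σ(g₂) ∥ g₁ - σ(g₂ g₁) + σ(g₁)`. -/
def dOne (K : Type) [Field K] (m : ℕ) :
    (SL(2, ℤ) → PolyLE K m) →ₗ[K] (SL(2, ℤ) × SL(2, ℤ) → PolyLE K m) :=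
  LinearMap.pi fun g =>
    polySlash K m g.1 ∘ₗ (LinearMap.proj g.2 : (SL(2, ℤ) → PolyLE K m) →ₗ[K] PolyLE K m)
      - LinearMap.proj (g.2 * g.1) + LinearMap.proj g.1

/-- `1`-cocycles `Z¹(Γ, P_m(K))`. -/
def cocycles (K : Type) [Field K] (m : ℕ) : Submodule K (SL(2, ℤ) → PolyLE K m) :=
  LinearMap.ker (dOne K m)

/-- `1`-coboundaries `B¹(Γ, P_m(K))`. -/
def coboundaries (K : Type) [Field K] (m : ℕ) : Submodule K (SL(2, ℤ) → PolyLE K m) :=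
  LinearMap.range (dZero K m)

/-- The cochains `ψ` with `ψ(T) = 0`, where `T = (1 1; 0 1)`. -/
def vanishAtT (K : Type) [Field K] (m : ℕ) : Submodule K (SL(2, ℤ) → PolyLE K m) :=
  LinearMap.ker (LinearMap.proj (R := K) (φ := fun _ : SL(2, ℤ) => PolyLE K m) ModularGroup.T)

/-- Parabolic cocycles `Z¹_par(Γ, P_m(K))`. -/
def parCocycles (K : Type) [Field K] (m : ℕ) : Submodule K (SL(2, ℤ) → PolyLE K m) :=
  cocycles K m ⊓ vanishAtT K m

/-- Parabolic coboundaries `B¹_par(Γ, P_m(K))`. -/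
def parCoboundaries (K : Type) [Field K] (m : ℕ) : Submodule K (SL(2, ℤ) → PolyLE K m) :=
  coboundaries K m ⊓ vanishAtT K m

/-- `H¹(Γ, P_m(K)) = Z¹ / B¹`. -/
abbrev HOne (K : Type) [Field K] (m : ℕ) : Type :=
  cocycles K m ⧸ (coboundaries K m).submoduleOf (cocycles K m)

/-- `H¹_par(Γ, P_m(K)) = Z¹_par / B¹_par`. -/
abbrev HOnePar (K : Type) [Field K] (m : ℕ) : Type :=
  parCocycles K m ⧸ (parCoboundaries K m).submoduleOf (parCocycles K m)

/-- The class in `H¹` of a cocycle. -/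
def cocycleClass (K : Type) [Field K] (m : ℕ) (σ : cocycles K m) : HOne K m :=
  Submodule.Quotient.mk σ

/-- The class in `H¹_par` of a parabolic cocycle. -/
def parCocycleClass (K : Type) [Field K] (m : ℕ) (σ : parCocycles K m) : HOnePar K m :=
  Submodule.Quotient.mk σ

lemma parCocycles_le (K : Type) [Field K] (m : ℕ) : parCocycles K m ≤ cocycles K m := inf_le_left

/-- The natural map `j : H¹_par(Γ, P_m(K)) → H¹(Γ, P_m(K))`, `[σ] ↦ [σ]`. -/
def natJ (K : Type) [Field K] (m : ℕ) : HOnePar K m →ₗ[K] HOne K m :=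
  Submodule.mapQ _ _ (Submodule.inclusion (parCocycles_le K m)) (fun _ hσ => hσ.1)

/-! ### Extension of scalars in cohomology -/

section BaseChange

variable (K : Type) [Field K] [Algebra K ℂ] (m : ℕ)

/-- The map `P_m(K) → P_m(ℂ)` induced by `K → ℂ`. -/
def polyExt : PolyLE K m →ₗ[K] PolyLE ℂ m where
  toFun p := .ofPoly (p.toPoly.map (algebraMap K ℂ)) (Polynomial.degree_map_le.trans p.degree_le)
  map_add' p q := by
    apply PolyLE.toPoly_injective
    simp [PolyLE.toPoly_ofPoly]
  map_smul' c p := by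
    apply PolyLE.toPoly_injective
    simp [PolyLE.toPoly_ofPoly, Polynomial.map_smul, algebraMap_smul]

lemma polyExt_toPoly (p : PolyLE K m) :
    (polyExt K m p).toPoly = p.toPoly.map (algebraMap K ℂ) := rfl

open Polynomial in
lemma polyExt_slash (γ : SL(2, ℤ)) (p : PolyLE K m) :
    polyExt K m (polySlash K m γ p) = polySlash ℂ m γ (polyExt K m p) := by
  apply PolyLE.toPoly_injective
  rw [polyExt_toPoly, polySlash_toPoly, polySlash_toPoly, polyExt_toPoly]
  simp only [slashRaw, Polynomial.map_sum, Polynomial.map_mul, Polynomial.map_pow,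
    Polynomial.map_add, map_C, map_X, coeff_map, map_intCast, Polynomial.map_intCast]

/-- The map on cochains `C¹(Γ, P_m(K)) → C¹(Γ, P_m(ℂ))` induced by `K → ℂ`. -/
def cochainExt : (SL(2, ℤ) → PolyLE K m) →ₗ[K] (SL(2, ℤ) → PolyLE ℂ m) :=
  LinearMap.pi fun γ => polyExt K m ∘ₗ LinearMap.proj γ

lemma cochainExt_cocycles {σ : SL(2, ℤ) → PolyLE K m} (hσ : σ ∈ cocycles K m) :
    cochainExt K m σ ∈ (cocycles ℂ m).restrictScalars K := by
  simp only [cocycles, LinearMap.mem_ker, Submodule.restrictScalars_mem] at hσ ⊢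
  ext1 g
  have h := congrArg (polyExt K m) (congrFun hσ g)
  simpa [dOne, cochainExt, polyExt_slash] using h

lemma cochainExt_coboundaries {σ : SL(2, ℤ) → PolyLE K m} (hσ : σ ∈ coboundaries K m) :
    cochainExt K m σ ∈ (coboundaries ℂ m).restrictScalars K := by
  obtain ⟨p, rfl⟩ := hσ
  refine ⟨polyExt K m p, ?_⟩
  ext1 g
  simp [dZero, cochainExt, polyExt_slash]

lemma cochainExt_vanishAtT {σ : SL(2, ℤ) → PolyLE K m} (hσ : σ ∈ vanishAtT K m) :
    cochainExt K m σ ∈ (vanishAtT ℂ m).restrictScalars K := by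
  simp only [vanishAtT, LinearMap.mem_ker, Submodule.restrictScalars_mem,
    LinearMap.proj_apply] at hσ ⊢
  simp [cochainExt, hσ]

/-- Extension of scalars on cocycles. -/
def cocycleExt : cocycles K m →ₗ[K] cocycles ℂ m where
  toFun σ := ⟨cochainExt K m σ.1, cochainExt_cocycles K m σ.2⟩
  map_add' σ τ := by ext1; simp
  map_smul' c σ := by ext1; simp

/-- Extension of scalars on parabolic cocycles. -/
def parCocycleExt : parCocycles K m →ₗ[K] parCocycles ℂ m where
  toFun σ := ⟨cochainExt K m σ.1,
    cochainExt_cocycles K m σ.2.1, cochainExt_vanishAtT K m σ.2.2⟩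
  map_add' σ τ := by ext1; simp
  map_smul' c σ := by ext1; simp

/-- The natural `ℂ`-linear map `ℂ ⊗ H¹(Γ, P_m(K)) → H¹(Γ, P_m(ℂ))`, `a ⊗ [σ] ↦ a [σ]`. -/
def compareH : ℂ ⊗[K] HOne K m →ₗ[ℂ] HOne ℂ m :=
  LinearMap.liftBaseChange ℂ <|
    Submodule.liftQ _
      (((Submodule.mkQ ((coboundaries ℂ m).submoduleOf (cocycles ℂ m))).restrictScalars K) ∘ₗ
        cocycleExt K m)
      (fun _ hσ => (Submodule.Quotient.mk_eq_zero _).mpr (cochainExt_coboundaries K m hσ))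

/-- The natural `ℂ`-linear map `ℂ ⊗ H¹_par(Γ, P_m(K)) → H¹_par(Γ, P_m(ℂ))`, `a ⊗ [σ] ↦ a [σ]`. -/
def compareHPar : ℂ ⊗[K] HOnePar K m →ₗ[ℂ] HOnePar ℂ m :=
  LinearMap.liftBaseChange ℂ <|
    Submodule.liftQ _
      (((Submodule.mkQ ((parCoboundaries ℂ m).submoduleOf
        (parCocycles ℂ m))).restrictScalars K) ∘ₗ parCocycleExt K m)
      (fun _ hσ => (Submodule.Quotient.mk_eq_zero _).mpr
        ⟨cochainExt_coboundaries K m hσ.1, cochainExt_vanishAtT K m hσ.2⟩)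

end BaseChange

/-! ### The two cocycles attached to a form -/

/-- `φ(f)(γ)(z) = ∫_i^{γ⁻¹ i} f(w) (w - z)^{k-2} dw`, integrated along the line segment from `i`
to `γ⁻¹ i` in the upper half-plane. -/
def eichlerIntegral (k : ℕ) (f : ℍ → ℂ) (γ : SL(2, ℤ)) (z : ℂ) : ℂ :=
  ∫ t in (0 : ℝ)..1,
    (f ∘ ofComplex) (AffineMap.lineMap Complex.I ((γ⁻¹ • UpperHalfPlane.I : ℍ) : ℂ) t) *
      (AffineMap.lineMap Complex.I ((γ⁻¹ • UpperHalfPlane.I : ℍ) : ℂ) t - z) ^ (k - 2) *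
      (((γ⁻¹ • UpperHalfPlane.I : ℍ) : ℂ) - Complex.I)

/-- The exponentially decaying part `f̃ = ∑_{n > 0} aₙ qⁿ`. -/
def decayingPart (f : ℍ → ℂ) (z : ℂ) : ℂ :=
  ∑' n : ℤ, if 0 < n then fourierCoef f n * qPow n z else 0

/-- The principal part `f̊ = ∑_{n < 0} aₙ qⁿ`: for a weakly holomorphic form this is a finite sum,
hence an entire function. -/
def principalPart (f : ℍ → ℂ) (z : ℂ) : ℂ :=
  ∑' n : ℤ, if n < 0 then fourierCoef f n * qPow n z else 0

/-- `∫_z^{i∞} g(w) (w - z)^{k-2} dw`, along the vertical half-line `w = z + i t`, `t > 0`. -/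
def integralUp (k : ℕ) (g : ℂ → ℂ) (z : ℂ) : ℂ :=
  ∫ t in Set.Ioi (0 : ℝ),
    g (z + Complex.I * t) * ((z + Complex.I * t) - z) ^ (k - 2) * Complex.I

/-- `∫_z^{-i∞} g(w) (w - z)^{k-2} dw`, along the vertical half-line `w = z - i t`, `t > 0`. -/
def integralDown (k : ℕ) (g : ℂ → ℂ) (z : ℂ) : ℂ :=
  ∫ t in Set.Ioi (0 : ℝ),
    g (z - Complex.I * t) * ((z - Complex.I * t) - z) ^ (k - 2) * (-Complex.I)

/-- `v'_f(z) = ∫_z^{i∞} f̃(w) (w - z)^{k-2} dw + ∫_z^{-i∞} f̊(w) (w - z)^{k-2} dw`. -/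
def vPrime (k : ℕ) (f : ℍ → ℂ) (z : ℍ) : ℂ :=
  integralUp k (decayingPart f) z + integralDown k (principalPart f) z

/-- The coboundary `(d⁰ v)(γ) = v ∥ γ - v` of a function `v` on the upper half-plane for the action
of weights `(-m, 0)`, `(v ∥ γ)(z) = (c z + d)^m v(γ z)`. -/
def dZeroFun (m : ℕ) (v : ℍ → ℂ) (γ : SL(2, ℤ)) (z : ℍ) : ℂ :=
  ((γ 1 0 : ℂ) * z + γ 1 1) ^ m * v (γ • z) - v z

/-- The polynomial valued cochain `σ` is `φ(f)`. -/
def IsEichlerCocycle (k : ℕ) (f : ℍ → ℂ) (σ : SL(2, ℤ) → PolyLE ℂ (k - 2)) : Prop :=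
  ∀ (γ : SL(2, ℤ)) (z : ℂ), (σ γ).toPoly.eval z = eichlerIntegral k f γ z

/-- The polynomial valued cochain `σ` is `φ'(f) = d⁰ v'_f`. -/
def IsCuspCocycle (k : ℕ) (f : ℍ → ℂ) (σ : SL(2, ℤ) → PolyLE ℂ (k - 2)) : Prop :=
  ∀ (γ : SL(2, ℤ)) (z : ℍ), (σ γ).toPoly.eval (z : ℂ) = dZeroFun (k - 2) (vPrime k f) γ z

end

/-!
Integrating the `q`-expansion of `f` termwise gives iterated primitives `F₁, F₂, …` of `F₀ = f`, and
repeated integration by parts turns them into a primitive of `f(w) (w - X)^{k-2}` that is a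
polynomial in `X`. Moving the base point from `i` to `z` shows that `φ(f)` is `d⁰` of a polynomial
plus a multiple of `F_{k-1}`; for a cusp form `v'_f` is exactly that multiple of `F_{k-1}`, so
`φ(f)` and `φ'(f)` differ by the coboundary of a polynomial. If `f = D^{k-1} g`, then `F_{k-1}` is a
multiple of `g - b₀`, where `b₀` is the constant term of `g`; as `d⁰ g = 0` by modularity, both
cocycles are coboundaries. That `D^{k-1} g` is modular is Bol's identity.

Cohomology commutes with the extension of scalars from `K` to `ℂ` because `K`-linear functionals
on the coefficients commute with the action of `Γ`, and because a cocycle is determined by its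
values at `S` and `T`, so that only finitely many elements of a `K`-basis of `ℂ` occur in its
coefficients.
-/

noncomputable section

/-! ### Series in `q` -/

lemma norm_qPow (n : ℤ) (z : ℂ) : ‖qPow n z‖ = Real.exp (-(2 * Real.pi * n * z.im)) := by
  rw [qPow, Complex.norm_exp]
  congr 1
  simp [Complex.mul_re, Complex.mul_im]

lemma norm_qPow_le_add (n : ℤ) {z₁ z z₂ : ℂ} (h₁ : z₁.im ≤ z.im) (h₂ : z.im ≤ z₂.im) :
    ‖qPow n z‖ ≤ ‖qPow n z₁‖ + ‖qPow n z₂‖ := by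
  simp only [norm_qPow]
  rcases le_total 0 n with hn | hn
  · have : (0 : ℝ) ≤ n := by exact_mod_cast hn
    refine le_add_of_le_of_nonneg ?_ (Real.exp_nonneg _)
    gcongr
  · have hn' : (n : ℝ) ≤ 0 := by exact_mod_cast hn
    refine le_add_of_nonneg_of_le (Real.exp_nonneg _) ?_
    gcongr Real.exp (-?_)
    exact mul_le_mul_of_nonpos_left h₂
      (mul_nonpos_of_nonneg_of_nonpos Real.two_pi_pos.le hn')

lemma qPow_add (m n : ℤ) (z : ℂ) : qPow (m + n) z = qPow m z * qPow n z := by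
  rw [qPow, qPow, qPow, ← Complex.exp_add]
  push_cast
  ring_nf

lemma qPow_add_arg (n : ℤ) (z w : ℂ) : qPow n (z + w) = qPow n z * qPow n w := by
  rw [qPow, qPow, qPow, ← Complex.exp_add]
  ring_nf

lemma qPow_zero (z : ℂ) : qPow 0 z = 1 := by simp [qPow]

lemma qPow_one_arg (n : ℤ) : qPow n 1 = 1 := by
  rw [qPow, Complex.exp_eq_one_iff]
  exact ⟨n, by ring⟩

lemma hasDerivAt_qPow (n : ℤ) (z : ℂ) :
    HasDerivAt (qPow n) (2 * Real.pi * Complex.I * n * qPow n z) z := by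
  have h := (hasDerivAt_const_mul (x := z) (2 * Real.pi * Complex.I * (n : ℂ))).cexp
  rwa [mul_comm (Complex.exp _)] at h

lemma continuous_qPow (n : ℤ) : Continuous (qPow n) := by
  unfold qPow
  fun_prop

lemma integral_qPow (n : ℤ) :
    ∫ x in (0 : ℝ)..1, qPow n (x + Complex.I) = if n = 0 then 1 else 0 := by
  split_ifs with hn
  · simp [hn, qPow_zero]
  · have hc : 2 * Real.pi * Complex.I * n ≠ 0 :=
      mul_ne_zero Complex.two_pi_I_ne_zero (Int.cast_ne_zero.mpr hn)
    have h1 : Complex.exp (2 * Real.pi * Complex.I * n) = 1 := by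
      simpa [qPow] using qPow_one_arg n
    simp_rw [qPow_add_arg n _ Complex.I]
    rw [intervalIntegral.integral_mul_const]
    simp only [qPow]
    rw [integral_exp_mul_complex hc]
    simp [h1]

/-- The two-sided coefficient sequences `a` for which the Laurent series `∑ aₙ qⁿ` converges
absolutely on the upper half-plane. -/
def qConvergent : Submodule ℂ (ℤ → ℂ) where
  carrier := {a | ∀ z : ℍ, Summable fun n => a n * qPow n z}
  zero_mem' z := by simp [summable_zero]
  add_mem' ha hb z := by simpa only [Pi.add_apply, add_mul] using (ha z).add (hb z)
  smul_mem' c a ha z := by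
    simpa only [Pi.smul_apply, smul_eq_mul, mul_assoc] using (ha z).mul_left c

lemma mem_qConvergent_of_norm_le {a b : ℤ → ℂ} (ha : a ∈ qConvergent) (h : ∀ n, ‖b n‖ ≤ ‖a n‖) :
    b ∈ qConvergent := fun z => by
  refine Summable.of_norm_bounded (ha z).norm fun n => ?_
  rw [norm_mul, norm_mul]
  exact mul_le_mul_of_nonneg_right (h n) (norm_nonneg _)

/-- The sum `∑ aₙ qⁿ` of a Laurent series in `q`, as a function on the upper half-plane. -/
def qSeries : qConvergent →ₗ[ℂ] (ℍ → ℂ) where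
  toFun a z := ∑' n, a.1 n * qPow n z
  map_add' a b := by
    ext z
    simpa only [Submodule.coe_add, Pi.add_apply, add_mul] using (a.2 z).tsum_add (b.2 z)
  map_smul' c a := by
    ext z
    simp [mul_assoc, tsum_mul_left]

lemma hasSum_qSeries (a : qConvergent) (z : ℍ) :
    HasSum (fun n => a.1 n * qPow n z) (qSeries a z) := (a.2 z).hasSum

lemma qSeries_apply_eq {a : qConvergent} {z : ℍ} {s : ℂ}
    (h : HasSum (fun n => a.1 n * qPow n z) s) : qSeries a z = s := h.tsum_eq

lemma qSeries_T_smul (a : qConvergent) (z : ℍ) : qSeries a (ModularGroup.T • z) = qSeries a z := by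
  refine qSeries_apply_eq ((hasSum_qSeries a z).congr_fun fun n => ?_)
  rw [UpperHalfPlane.modular_T_smul, UpperHalfPlane.coe_vadd, Complex.ofReal_one, qPow_add_arg,
    qPow_one_arg, one_mul]

lemma fourierCoef_qSeries (a : qConvergent) (n : ℤ) : fourierCoef (qSeries a) n = a.1 n := by
  have hs (x : ℝ) : HasSum (fun k => a.1 k * qPow (k - n) (x + Complex.I))
      ((qSeries a ∘ ofComplex) (x + Complex.I) * qPow (-n) (x + Complex.I)) := by
    have hx : 0 < ((x : ℂ) + Complex.I).im := by simp
    rw [Function.comp_apply, ofComplex_apply_of_im_pos hx]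
    refine ((hasSum_qSeries a ⟨_, hx⟩).mul_right _).congr_fun fun k => ?_
    rw [sub_eq_add_neg, qPow_add, ← mul_assoc]
  have hnorm (k : ℤ) (x : ℝ) : ‖a.1 k * qPow (k - n) (x + Complex.I)‖ =
      ‖a.1 k * qPow (k - n) ((0 : ℝ) + Complex.I)‖ := by
    simp [norm_qPow]
  have h := intervalIntegral.hasSum_integral_of_dominated_convergence (μ := volume)
    (a := 0) (b := 1) (F := fun k (x : ℝ) => a.1 k * qPow (k - n) (x + Complex.I))
    (fun k _ => ‖a.1 k * qPow (k - n) ((0 : ℝ) + Complex.I)‖)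
    (fun k => (continuous_const.mul
      ((continuous_qPow _).comp (by fun_prop))).aestronglyMeasurable)
    (fun k => .of_forall fun x _ => (hnorm k x).le)
    (.of_forall fun _ _ => (hs 0).summable.norm) (by simp)
    (.of_forall fun x _ => hs x)
  refine h.unique ?_
  simp_rw [intervalIntegral.integral_const_mul, integral_qPow, sub_eq_zero, mul_ite, mul_one,
    mul_zero]
  convert! hasSum_ite_eq n (a.1 n) using 2 with k
  split_ifs with h <;> simp [h]

/-- `F` is a primitive of `f` on the upper half-plane. -/
def IsPrimitive (F f : ℍ → ℂ) : Prop := ∀ z : ℍ, HasDerivAt (F ∘ ofComplex) (f z) z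

lemma IsPrimitive.normalizedDeriv {F f : ℍ → ℂ} (h : IsPrimitive F f) :
    Derivative.normalizedDerivOfComplex F = (2 * Real.pi * Complex.I)⁻¹ • f := by
  ext z
  rw [Derivative.normalizedDerivOfComplex, (h z).deriv, Pi.smul_apply, smul_eq_mul]

lemma hasSum_deriv_qSeries (a : qConvergent) (z : ℍ) :
    HasSum (fun n : ℤ => 2 * Real.pi * Complex.I * n * a.1 n * qPow n z)
        (deriv (qSeries a ∘ ofComplex) z) ∧
      DifferentiableAt ℂ (qSeries a ∘ ofComplex) z := by
  set U : Set ℂ := {w | z.im / 2 < w.im} ∩ {w | w.im < 2 * z.im}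
  have hU : IsOpen U :=
    (isOpen_lt continuous_const Complex.continuous_im).inter
      (isOpen_lt Complex.continuous_im continuous_const)
  have hzU : (z : ℂ) ∈ U := ⟨half_lt_self z.im_pos, lt_two_mul_self z.im_pos⟩
  let z₁ : ℍ := ⟨(z.im / 2 : ℝ) * Complex.I, by simpa using z.im_pos⟩
  let z₂ : ℍ := ⟨(2 * z.im : ℝ) * Complex.I, by simpa using z.im_pos⟩
  have hu := (a.2 z₁).norm.add (a.2 z₂).norm
  have hd (n : ℤ) (w : ℂ) : HasDerivAt (fun w => a.1 n * qPow n w)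
      (2 * Real.pi * Complex.I * n * a.1 n * qPow n w) w := by
    convert! (hasDerivAt_qPow n w).const_mul (a.1 n) using 1
    ring
  have hdU (n : ℤ) : DifferentiableOn ℂ (fun w => a.1 n * qPow n w) U := fun w _ =>
    (hd n w).differentiableAt.differentiableWithinAt
  have hle (n : ℤ) (w : ℂ) (hw : w ∈ U) :
      ‖a.1 n * qPow n w‖ ≤ ‖a.1 n * qPow n z₁‖ + ‖a.1 n * qPow n z₂‖ := by
    simp only [norm_mul, ← mul_add]
    refine mul_le_mul_of_nonneg_left (norm_qPow_le_add n ?_ ?_) (norm_nonneg _)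
    · simpa [z₁] using hw.1.le
    · simpa [z₂] using hw.2.le
  have he : qSeries a ∘ ofComplex =ᶠ[nhds (z : ℂ)] fun w => ∑' n, a.1 n * qPow n w := by
    filter_upwards [UpperHalfPlane.isOpen_upperHalfPlaneSet.mem_nhds z.im_pos] with w hw
    rw [Function.comp_apply, ofComplex_apply_of_im_pos hw]
    rfl
  refine ⟨?_, (he.differentiableAt_iff).mpr ((Complex.differentiableOn_tsum_of_summable_norm
    hu hdU hU hle).differentiableAt (hU.mem_nhds hzU))⟩
  rw [he.deriv_eq]
  simpa only [(hd _ _).deriv] using Complex.hasSum_deriv_of_summable_norm hu hdU hU hle hzU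

/-- The Euler operator `q d/dq` on coefficient sequences, `(aₙ) ↦ (n aₙ)`. -/
def eulerOp : qConvergent →ₗ[ℂ] qConvergent where
  toFun a := ⟨fun n => n * a.1 n, fun z => by
    refine ((hasSum_deriv_qSeries a z).1.summable.mul_left
      (2 * Real.pi * Complex.I)⁻¹).congr fun n => ?_
    rw [mul_assoc (2 * Real.pi * Complex.I), mul_assoc (2 * Real.pi * Complex.I),
      inv_mul_cancel_left₀ Complex.two_pi_I_ne_zero]⟩
  map_add' a b := by ext n; simp [mul_add]
  map_smul' c a := by ext n; simp [mul_left_comm]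

lemma eulerOp_pow_apply (j : ℕ) (a : qConvergent) (n : ℤ) :
    ((eulerOp ^ j) a).1 n = (n : ℂ) ^ j * a.1 n := by
  induction j with
  | zero => simp
  | succ j ih =>
    rw [pow_succ', pow_succ', Module.End.mul_apply, mul_assoc, ← ih]
    rfl

lemma isPrimitive_qSeries (a : qConvergent) :
    IsPrimitive (qSeries a) (qSeries ((2 * Real.pi * Complex.I : ℂ) • eulerOp a)) := fun z => by
  obtain ⟨hsum, hdiff⟩ := hasSum_deriv_qSeries a z
  rw [qSeries_apply_eq (hsum.congr_fun fun n => ?_)]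
  · exact hdiff.hasDerivAt
  · simp [eulerOp, mul_assoc]

lemma iterD_succ (n : ℕ) (f : ℍ → ℂ) :
    iterD (n + 1) f = Derivative.normalizedDerivOfComplex (iterD n f) :=
  Function.iterate_succ_apply' _ _ _

lemma iterD_qSeries (j : ℕ) (a : qConvergent) :
    iterD j (qSeries a) = qSeries ((eulerOp ^ j) a) := by
  induction j with
  | zero => rfl
  | succ j ih =>
    rw [iterD_succ, ih, (isPrimitive_qSeries _).normalizedDeriv, ← map_smul,
      inv_smul_smul₀ Complex.two_pi_I_ne_zero, pow_succ', Module.End.mul_apply]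

/-- The Fourier coefficients of a weakly holomorphic form. -/
def qCoeffs (w : ℤ) : weakForms ℂ w →ₗ[ℂ] qConvergent where
  toFun f := ⟨fourierCoef f, fun z => (f.2.1.hasSum z).summable⟩
  map_add' f g := by ext n; exact fourierCoef_add f.2.1.mdiff g.2.1.mdiff n
  map_smul' c f := by ext n; exact fourierCoef_smul c f n

lemma qCoeffs_apply {w : ℤ} (f : weakForms ℂ w) (n : ℤ) : (qCoeffs w f).1 n = fourierCoef f n := rfl

lemma qSeries_qCoeffs {w : ℤ} (f : weakForms ℂ w) : qSeries (qCoeffs w f) = f := by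
  ext z
  exact qSeries_apply_eq (f.2.1.hasSum z)

lemma IsWeaklyHolomorphic.mem_weakForms {w : ℤ} {f : ℍ → ℂ} (hf : IsWeaklyHolomorphic w f) :
    f ∈ weakForms ℂ w := ⟨hf, fun _ => ⟨_, rfl⟩⟩

lemma iterD_eq_qSeries {w : ℤ} (g : weakForms ℂ w) (j : ℕ) :
    iterD j g = qSeries ((eulerOp ^ j) (qCoeffs w g)) := by
  rw [← iterD_qSeries, qSeries_qCoeffs]

lemma fourierCoef_iterD {w : ℤ} {g : ℍ → ℂ} (hg : IsWeaklyHolomorphic w g) (j : ℕ) (n : ℤ) :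
    fourierCoef (iterD j g) n = (n : ℂ) ^ j * fourierCoef g n := by
  rw [iterD_eq_qSeries ⟨g, hg.mem_weakForms⟩, fourierCoef_qSeries, eulerOp_pow_apply, qCoeffs_apply]

/-! ### Bol's identity -/

section Bol

open scoped ModularForm

lemma normalizedDeriv_denom (γ : SL(2, ℤ)) :
    Derivative.normalizedDerivOfComplex (fun z : ℍ => denom γ z) =
      fun _ => (2 * Real.pi * Complex.I)⁻¹ * (γ 1 0 : ℂ) := by
  ext z
  have he : (fun z : ℍ => denom γ z) ∘ ofComplex =ᶠ[nhds (z : ℂ)] fun z => denom γ z ^ (1 : ℤ) := by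
    filter_upwards [UpperHalfPlane.isOpen_upperHalfPlaneSet.mem_nhds z.im_pos] with w hw
    rw [Function.comp_apply, ofComplex_apply_of_im_pos hw, zpow_one]
  rw [Derivative.normalizedDerivOfComplex, he.deriv_eq, deriv_denom_zpow]
  simp

lemma iterD_denom_mul (γ : SL(2, ℤ)) (n : ℕ) {f : ℍ → ℂ} (hf : MDiff f) :
    iterD (n + 1) ((fun z : ℍ => denom γ z) * f) = (fun z : ℍ => denom γ z) * iterD (n + 1) f +
      ((n + 1) * ((2 * Real.pi * Complex.I)⁻¹ * (γ 1 0 : ℂ))) • iterD n f := by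
  induction n with
  | zero =>
    rw [iterD_succ, iterD_succ]
    change Derivative.normalizedDerivOfComplex (_ * f) =
      _ * Derivative.normalizedDerivOfComplex f + _ • f
    rw [Derivative.normalizedDerivOfComplex_mul _ _ (mdifferentiable_denom _) hf,
      normalizedDeriv_denom]
    ext z
    simp only [Pi.add_apply, Pi.mul_apply, Pi.smul_apply, smul_eq_mul, CharP.cast_eq_zero, zero_add]
    ring
  | succ n ih =>
    have h1 := iterD_mdiff (n + 1) hf
    have h2 := iterD_mdiff n hf
    rw [iterD_succ, ih, Derivative.normalizedDerivOfComplex_add _ _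
        ((mdifferentiable_denom _).mul h1) (h2.const_smul _),
      Derivative.normalizedDerivOfComplex_mul _ _ (mdifferentiable_denom _) h1,
      Derivative.normalizedDerivOfComplex_smul _ _ h2, normalizedDeriv_denom, ← iterD_succ,
      ← iterD_succ]
    ext z
    simp only [Pi.add_apply, Pi.mul_apply, Pi.smul_apply, smul_eq_mul, Nat.cast_add, Nat.cast_one]
    ring

lemma iterD_slash (γ : SL(2, ℤ)) (n : ℕ) {f : ℍ → ℂ} (hf : MDiff f) :
    iterD n (f ∣[(1 - n : ℤ)] γ) = iterD n f ∣[(1 + n : ℤ)] γ := by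
  induction n with
  | zero => simp [iterD]
  | succ n ih =>
    have h : f ∣[(1 - (n + 1 : ℕ) : ℤ)] γ = (fun z : ℍ => denom γ z) * (f ∣[(1 - n : ℤ)] γ) := by
      ext z
      rw [Pi.mul_apply, ModularForm.SL_slash_apply, ModularForm.SL_slash_apply,
        show -(1 - (n + 1 : ℕ) : ℤ) = 1 + -(1 - n) by push_cast; ring,
        zpow_one_add₀ (denom_ne_zero _ _)]
      ring
    have hslash : MDiff (f ∣[(1 - n : ℤ)] γ) := hf.slash _ _
    rw [h, iterD_denom_mul γ n hslash, iterD_succ, ih,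
      Derivative.normalizedDerivOfComplex_SL_slash (iterD_mdiff n hf), ← iterD_succ]
    ext z
    have hz := denom_ne_zero (γ : GL (Fin 2) ℝ) z
    simp only [Pi.add_apply, Pi.mul_apply, Pi.sub_apply, Pi.smul_apply, smul_eq_mul,
      ModularForm.SL_slash_apply]
    rw [show -(1 + n + 2 : ℤ) = -(1 + (n + 1 : ℕ)) + -1 by push_cast; ring,
      zpow_add₀ hz, zpow_neg_one]
    push_cast
    field_simp
    ring

lemma factor_ne_zero (γ : SL(2, ℤ)) (z : ℍ) : (γ 1 0 : ℂ) * z + γ 1 1 ≠ 0 := by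
  simpa [denom] using denom_ne_zero (γ : GL (Fin 2) ℝ) z

lemma slash_eq_iff (w : ℤ) (γ : SL(2, ℤ)) (f : ℍ → ℂ) :
    f ∣[w] γ = f ↔ ∀ z : ℍ, f (γ • z) = ((γ 1 0 : ℂ) * z + γ 1 1) ^ w * f z := by
  rw [funext_iff]
  refine forall_congr' fun z => ?_
  have hd : denom (γ : GL (Fin 2) ℝ) z = (γ 1 0 : ℂ) * z + γ 1 1 := by simp [denom]
  rw [ModularForm.SL_slash_apply, hd, zpow_neg, ← div_eq_mul_inv,
    div_eq_iff (zpow_ne_zero _ (factor_ne_zero γ z)), mul_comm]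

end Bol

lemma IsWeaklyHolomorphic.iterD {k : ℕ} (hk : 1 ≤ k) {g : ℍ → ℂ}
    (hg : IsWeaklyHolomorphic (2 - k) g) : IsWeaklyHolomorphic k (iterD (k - 1) g) where
  mdiff := iterD_mdiff _ hg.mdiff
  modular γ := by
    rw [← slash_eq_iff]
    have h := iterD_slash γ (k - 1) hg.mdiff
    rw [show (1 - (k - 1 : ℕ) : ℤ) = 2 - k by omega, show (1 + (k - 1 : ℕ) : ℤ) = k by omega,
      (slash_eq_iff _ γ g).mpr (hg.modular γ)] at h
    exact h.symm
  principal := by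
    obtain ⟨N, hN⟩ := hg.principal
    exact ⟨N, fun n hn => by rw [fourierCoef_iterD hg, hN n hn, mul_zero]⟩
  hasSum z := by
    rw [iterD_eq_qSeries ⟨g, hg.mem_weakForms⟩]
    simpa only [fourierCoef_qSeries] using hasSum_qSeries _ z

lemma exactForms_le (K : Type) [Field K] [Algebra K ℂ] {k : ℕ} (hk : 2 ≤ k) :
    exactForms K k ≤ weakCuspForms K k := by
  rintro _ ⟨g, hg, rfl⟩
  refine ⟨⟨hg.1.iterD (by omega), fun n => ?_⟩, ?_⟩
  · obtain ⟨a, ha⟩ := hg.2 n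
    exact ⟨n ^ (k - 1) * a, by rw [fourierCoef_iterD hg.1, map_mul, ha]; simp⟩
  · rw [fourierCoef_iterD hg.1, Int.cast_zero, zero_pow (by omega), zero_mul]

/-! ### Iterated primitives -/

lemma isPrimitive_iff_of_eqOn {F f : ℍ → ℂ} {G : ℂ → ℂ} (hG : ∀ z : ℍ, G z = F z) :
    IsPrimitive F f ↔ ∀ z : ℍ, HasDerivAt G (f z) z := by
  refine forall_congr' fun z => Filter.EventuallyEq.hasDerivAt_iff ?_
  filter_upwards [UpperHalfPlane.isOpen_upperHalfPlaneSet.mem_nhds z.im_pos] with w hw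
  rw [Function.comp_apply, ofComplex_apply_of_im_pos hw, ← hG]

lemma IsPrimitive.add {F f G g : ℍ → ℂ} (hF : IsPrimitive F f) (hG : IsPrimitive G g) :
    IsPrimitive (F + G) (f + g) := fun z => (hF z).add (hG z)

lemma IsPrimitive.sub_eq_sub {F G f : ℍ → ℂ} (hF : IsPrimitive F f) (hG : IsPrimitive G f)
    (p q : ℍ) : F p - G p = F q - G q := by
  have hderiv {u : ℂ} (hu : 0 < u.im) :
      HasDerivAt (fun u => F (ofComplex u) - G (ofComplex u)) 0 u := by
    simpa using (hF ⟨u, hu⟩).fun_sub (hG ⟨u, hu⟩)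
  have h := UpperHalfPlane.isOpen_upperHalfPlaneSet.is_const_of_deriv_eq_zero
    (convex_halfSpace_im_gt 0).isPreconnected
    (fun _ hu => (hderiv hu).differentiableAt.differentiableWithinAt)
    (fun _ hu => (hderiv hu).deriv) p.im_pos q.im_pos
  simpa using h

lemma IsPrimitive.integral_lineMap {F f : ℍ → ℂ} (hF : IsPrimitive F f) (hf : Continuous f)
    (p q : ℍ) :
    ∫ t in (0 : ℝ)..1, (f ∘ ofComplex) (AffineMap.lineMap (p : ℂ) q t) * (q - p) = F q - F p := by
  have hfU : ContinuousOn (f ∘ ofComplex) {z | 0 < z.im} := hf.comp_continuousOn fun z hz =>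
    (mdifferentiableAt_ofComplex hz).continuousAt.continuousWithinAt
  have him : ∀ t ∈ Set.uIcc (0 : ℝ) 1, 0 < (AffineMap.lineMap (p : ℂ) q t).im := fun t ht => by
    rw [Set.uIcc_of_le zero_le_one] at ht
    exact (convex_halfSpace_im_gt 0).lineMap_mem p.im_pos q.im_pos ht
  have hderiv : ∀ t ∈ Set.uIcc (0 : ℝ) 1, HasDerivAt
      (fun t : ℝ => (F ∘ ofComplex) (AffineMap.lineMap (p : ℂ) q t))
      ((f ∘ ofComplex) (AffineMap.lineMap (p : ℂ) q t) * (q - p)) t := fun t ht => by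
    rw [Function.comp_apply (f := f), ofComplex_apply_of_im_pos (him t ht)]
    exact (hF ⟨_, him t ht⟩).comp_of_eq t AffineMap.hasDerivAt_lineMap rfl
  have hcont : ContinuousOn (fun t : ℝ => (f ∘ ofComplex) (AffineMap.lineMap (p : ℂ) q t) * (q - p))
      (Set.uIcc 0 1) :=
    (hfU.comp AffineMap.lineMap_continuous.continuousOn him).mul continuousOn_const
  rw [intervalIntegral.integral_eq_sub_of_hasDerivAt hderiv hcont.intervalIntegrable]
  simp

lemma one_le_norm_two_pi_I_mul {n : ℤ} (hn : n ≠ 0) :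
    1 ≤ ‖(2 * Real.pi * Complex.I * n : ℂ)‖ := by
  have h : ‖(2 * Real.pi * Complex.I * n : ℂ)‖ = 2 * Real.pi * |(n : ℝ)| := by
    simp [abs_of_pos Real.pi_pos]
  rw [h]
  have h1 : (1 : ℝ) ≤ |(n : ℝ)| := by exact_mod_cast Int.one_le_abs hn
  nlinarith [Real.two_le_pi]

/-- The coefficients `aₙ / (2 π i n)^r`, `n ≠ 0`, of the `r`-fold primitive of the non-constant
part of `∑ aₙ qⁿ`; the constant coefficient is set to `0`. -/
def primCoef (r : ℕ) : qConvergent →ₗ[ℂ] qConvergent where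
  toFun a := ⟨fun n => if n = 0 then 0 else a.1 n / (2 * Real.pi * Complex.I * n) ^ r, by
    refine mem_qConvergent_of_norm_le a.2 fun n => ?_
    split_ifs with hn
    · simp
    · rw [norm_div, norm_pow]
      exact div_le_self (norm_nonneg _) (one_le_pow₀ (one_le_norm_two_pi_I_mul hn))⟩
  map_add' a b := by
    ext n
    by_cases hn : n = 0 <;> simp [hn, add_div]
  map_smul' c a := by
    ext n
    by_cases hn : n = 0 <;> simp [hn, mul_div_assoc]

lemma primCoef_apply_zero (r : ℕ) (a : qConvergent) : (primCoef r a).1 0 = 0 := by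
  simp [primCoef]

lemma primCoef_apply (r : ℕ) (a : qConvergent) {n : ℤ} (hn : n ≠ 0) :
    (primCoef r a).1 n = a.1 n / (2 * Real.pi * Complex.I * n) ^ r := if_neg hn

lemma two_pi_I_smul_eulerOp_primCoef (r : ℕ) (a : qConvergent) :
    (2 * Real.pi * Complex.I : ℂ) • eulerOp (primCoef (r + 1) a) = primCoef r a := by
  ext n
  change 2 * Real.pi * Complex.I * (n * (primCoef (r + 1) a).1 n) = _
  rcases eq_or_ne n 0 with rfl | hn
  · simp [primCoef_apply_zero]
  · have := mul_ne_zero Complex.two_pi_I_ne_zero (Int.cast_ne_zero.mpr hn)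
    rw [primCoef_apply _ _ hn, primCoef_apply _ _ hn, pow_succ, ← mul_assoc]
    field_simp

lemma qSeries_primCoef_zero (a : qConvergent) (z : ℍ) :
    qSeries (primCoef 0 a) z = qSeries a z - a.1 0 := by
  refine qSeries_apply_eq (((hasSum_qSeries a z).sub (hasSum_ite_eq 0 (a.1 0))).congr_fun
    fun n => ?_)
  rcases eq_or_ne n 0 with rfl | hn
  · simp [primCoef_apply_zero, qPow_zero]
  · simp [primCoef_apply, hn]

lemma primCoef_eulerOp_pow (r : ℕ) (a : qConvergent) :
    primCoef r ((eulerOp ^ r) a) = ((2 * Real.pi * Complex.I : ℂ) ^ r)⁻¹ • primCoef 0 a := by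
  ext n
  change _ = ((2 * Real.pi * Complex.I : ℂ) ^ r)⁻¹ * (primCoef 0 a).1 n
  rcases eq_or_ne n 0 with rfl | hn
  · simp [primCoef_apply_zero]
  · have := pow_ne_zero r (Int.cast_ne_zero (α := ℂ).mpr hn)
    rw [primCoef_apply _ _ hn, primCoef_apply _ _ hn, eulerOp_pow_apply,
      mul_pow _ (n : ℂ), pow_zero, div_one, mul_div_mul_comm, inv_mul_eq_div]
    field_simp

/-- The `r`-fold primitives `∑_{n ≠ 0} aₙ (2 π i n)^{-r} qⁿ + a₀ z ^ r / r!` of `∑ aₙ qⁿ`. -/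
def iterPrim : qConvergent →ₗ[ℂ] (ℕ → ℍ → ℂ) where
  toFun a r z := qSeries (primCoef r a) z + a.1 0 * ((z : ℂ) ^ r / r.factorial)
  map_add' a b := by
    ext r z
    simp [add_mul, add_add_add_comm]
  map_smul' c a := by
    ext r z
    simp [mul_add, mul_assoc]

lemma iterPrim_apply (a : qConvergent) (r : ℕ) (z : ℍ) :
    iterPrim a r z = qSeries (primCoef r a) z + a.1 0 * ((z : ℂ) ^ r / r.factorial) := rfl

lemma iterPrim_zero (a : qConvergent) : iterPrim a 0 = qSeries a := by
  ext z
  simp [iterPrim_apply, qSeries_primCoef_zero]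

lemma isPrimitive_iterPrim (a : qConvergent) (r : ℕ) :
    IsPrimitive (iterPrim a (r + 1)) (iterPrim a r) := by
  have hq := isPrimitive_qSeries (primCoef (r + 1) a)
  rw [two_pi_I_smul_eulerOp_primCoef] at hq
  refine hq.add ((isPrimitive_iff_of_eqOn
    (G := fun z => a.1 0 * (z ^ (r + 1) / (r + 1).factorial)) fun _ => rfl).mpr fun z => ?_)
  convert! ((hasDerivAt_pow (r + 1) (z : ℂ)).div_const _).const_mul (a.1 0) using 2
  rw [Nat.factorial_succ, Nat.cast_mul, Nat.add_sub_cancel,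
    mul_div_mul_left _ _ (Nat.cast_ne_zero.mpr r.succ_ne_zero)]

/-! ### Cochains defined by functions on the upper half-plane -/

lemma PolyLE.ext_eval {m : ℕ} {p q : PolyLE ℂ m}
    (h : ∀ z : ℍ, p.toPoly.eval (z : ℂ) = q.toPoly.eval (z : ℂ)) : p = q := by
  have him (n : ℕ) : 0 < ((n + 1 : ℂ) * Complex.I).im := by simpa using n.cast_add_one_pos
  have hinj : Function.Injective fun n : ℕ => (n + 1 : ℂ) * Complex.I := fun n n' hn => by
    exact_mod_cast add_right_cancel (mul_right_cancel₀ Complex.I_ne_zero hn)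
  refine PolyLE.toPoly_injective (Polynomial.eq_of_infinite_eval_eq _ _
    ((Set.infinite_range_of_injective hinj).mono ?_))
  rintro _ ⟨n, rfl⟩
  exact h ⟨_, him n⟩

lemma coe_smul_eq (γ : SL(2, ℤ)) (z : ℍ) :
    ((γ • z : ℍ) : ℂ) = ((γ 0 0 : ℂ) * z + γ 0 1) / ((γ 1 0 : ℂ) * z + γ 1 1) := by
  simp [UpperHalfPlane.specialLinearGroup_apply]

lemma det_eq_one (γ : SL(2, ℤ)) : (γ 0 0 : ℂ) * γ 1 1 - γ 0 1 * γ 1 0 = 1 := by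
  have h := γ.det_coe
  rw [Matrix.det_fin_two] at h
  exact_mod_cast h

lemma factor_mul (g₂ g₁ : SL(2, ℤ)) (z : ℍ) :
    ((g₂ * g₁) 1 0 : ℂ) * z + (g₂ * g₁) 1 1 =
      ((g₂ 1 0 : ℂ) * (g₁ • z : ℍ) + g₂ 1 1) * ((g₁ 1 0 : ℂ) * z + g₁ 1 1) := by
  rw [coe_smul_eq, add_mul, ← mul_div_assoc, div_mul_cancel₀ _ (factor_ne_zero g₁ z)]
  simp only [Matrix.SpecialLinearGroup.coe_mul, Matrix.mul_apply, Fin.sum_univ_two, Int.cast_add,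
    Int.cast_mul]
  ring

lemma coe_smul_sub_coe_smul (γ : SL(2, ℤ)) (u z : ℍ) :
    ((γ • u : ℍ) : ℂ) - (γ • z : ℍ) =
      (u - z) / (((γ 1 0 : ℂ) * u + γ 1 1) * ((γ 1 0 : ℂ) * z + γ 1 1)) := by
  rw [coe_smul_eq, coe_smul_eq, div_sub_div _ _ (factor_ne_zero γ u) (factor_ne_zero γ z)]
  congr 1
  linear_combination ((u : ℂ) - z) * det_eq_one γ

lemma polySlash_eval_coe (m : ℕ) (γ : SL(2, ℤ)) (p : PolyLE ℂ m) (z : ℍ) :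
    (polySlash ℂ m γ p).toPoly.eval (z : ℂ) =
      ((γ 1 0 : ℂ) * z + γ 1 1) ^ m * p.toPoly.eval ((γ • z : ℍ) : ℂ) := by
  rw [polySlash_eval m γ p z (factor_ne_zero γ z), coe_smul_eq]

lemma dZero_eval (m : ℕ) (p : PolyLE ℂ m) (γ : SL(2, ℤ)) (z : ℍ) :
    (dZero ℂ m p γ).toPoly.eval (z : ℂ) =
      dZeroFun m (fun z => p.toPoly.eval (z : ℂ)) γ z := by
  rw [dZeroFun, ← polySlash_eval_coe]
  simp [dZero]

lemma mem_cocycles_iff {K : Type} [Field K] {m : ℕ} {σ : SL(2, ℤ) → PolyLE K m} :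
    σ ∈ cocycles K m ↔ ∀ g₁ g₂, σ (g₂ * g₁) = polySlash K m g₁ (σ g₂) + σ g₁ := by
  rw [cocycles, LinearMap.mem_ker, funext_iff, Prod.forall]
  refine forall₂_congr fun g₁ g₂ => ?_
  simp only [dOne, LinearMap.pi_apply, LinearMap.add_apply, LinearMap.sub_apply,
    LinearMap.comp_apply, LinearMap.proj_apply, Pi.zero_apply]
  rw [sub_add_eq_add_sub, sub_eq_zero, eq_comm]

lemma mem_cocycles_of_dZeroFun {m : ℕ} {σ : SL(2, ℤ) → PolyLE ℂ m} {v : ℍ → ℂ}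
    (h : ∀ γ (z : ℍ), (σ γ).toPoly.eval (z : ℂ) = dZeroFun m v γ z) : σ ∈ cocycles ℂ m := by
  rw [mem_cocycles_iff]
  intro g₁ g₂
  refine PolyLE.ext_eval fun z => ?_
  rw [map_add, Polynomial.eval_add, polySlash_eval_coe, h, h, h, dZeroFun, dZeroFun, dZeroFun,
    factor_mul, mul_smul, mul_pow]
  ring

lemma mem_vanishAtT_of_dZeroFun {m : ℕ} {σ : SL(2, ℤ) → PolyLE ℂ m} {v : ℍ → ℂ}
    (h : ∀ γ (z : ℍ), (σ γ).toPoly.eval (z : ℂ) = dZeroFun m v γ z)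
    (hv : ∀ z : ℍ, v (ModularGroup.T • z) = v z) : σ ∈ vanishAtT ℂ m := by
  rw [vanishAtT, LinearMap.mem_ker, LinearMap.proj_apply]
  refine PolyLE.ext_eval fun z => ?_
  rw [h, dZeroFun, hv]
  simp [ModularGroup.T]

/-! ### The Eichler kernel -/

lemma isPrimitive_coe_sub_pow (z : ℂ) (n : ℕ) :
    IsPrimitive (fun w => ((w : ℂ) - z) ^ n) (fun w => n * ((w : ℂ) - z) ^ (n - 1)) :=
  (isPrimitive_iff_of_eqOn (G := fun w => (w - z) ^ n) fun _ => rfl).mpr fun w => by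
    simpa using ((hasDerivAt_id (w : ℂ)).sub_const z).fun_pow n

lemma IsPrimitive.mul {F f G g : ℍ → ℂ} (hF : IsPrimitive F f) (hG : IsPrimitive G g) :
    IsPrimitive (fun z => F z * G z) (fun z => f z * G z + F z * g z) := fun z => by
  convert! (hF z).fun_mul (hG z) using 1
  simp

lemma IsPrimitive.const_mul {F f : ℍ → ℂ} (hF : IsPrimitive F f) (c : ℂ) :
    IsPrimitive (fun z => c * F z) (fun z => c * f z) := fun z => (hF z).const_mul c

lemma IsPrimitive.sum {ι : Type*} {s : Finset ι} {F f : ι → ℍ → ℂ}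
    (h : ∀ i ∈ s, IsPrimitive (F i) (f i)) :
    IsPrimitive (fun z => ∑ i ∈ s, F i z) (fun z => ∑ i ∈ s, f i z) := fun z =>
  HasDerivAt.fun_sum fun i hi => h i hi z

lemma IsPrimitive.comp_smul {F f : ℍ → ℂ} (hF : IsPrimitive F f) (γ : SL(2, ℤ)) :
    IsPrimitive (fun z => F (γ • z)) (fun z => f (γ • z) / ((γ 1 0 : ℂ) * z + γ 1 1) ^ 2) := by
  intro z
  have hdet : (γ : GL (Fin 2) ℝ).val.det = 1 := by
    rw [← Matrix.GeneralLinearGroup.val_det_apply]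
    simp
  have hγ := (UpperHalfPlane.hasStrictDerivAt_smul (g := (γ : GL (Fin 2) ℝ))
    (hdet ▸ zero_lt_one) z).hasDerivAt
  convert! (hF (γ • z)).comp_of_eq (z : ℂ) hγ (by simp) using 1
  · ext u
    simp
  · rw [hdet]
    simp [denom, div_eq_mul_inv]

open Polynomial in
/-- The Eichler kernel of a sequence `F` of iterated primitives: the polynomial
`∑ᵢ (-1)ⁱ m! / (m - i)! F_{i+1}(w) (w - X)^{m-i}`, obtained from `∫ F₀(w) (w - X)^m dw` by repeated
integration by parts. -/
def eichlerKernel (m : ℕ) : (ℕ → ℍ → ℂ) →ₗ[ℂ] (ℍ → PolyLE ℂ m) where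
  toFun F w := .ofPoly (∑ i ∈ Finset.range (m + 1),
    C ((-1) ^ i * m.descFactorial i * F (i + 1) w) * (C (w : ℂ) - X) ^ (m - i)) <| by
      refine degree_le_of_natDegree_le (natDegree_sum_le_of_forall_le _ _ fun i _ => ?_)
      refine (natDegree_C_mul_le _ _).trans ((natDegree_pow_le_of_le (m - i) (m := 1) ?_).trans ?_)
      · exact (natDegree_sub_le _ _).trans (by simp)
      · omega
  map_add' F G := by
    ext1 w
    apply PolyLE.toPoly_injective
    simp [PolyLE.toPoly_ofPoly, mul_add, add_mul, Finset.sum_add_distrib]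
  map_smul' c F := by
    ext1 w
    apply PolyLE.toPoly_injective
    simp [PolyLE.toPoly_ofPoly, smul_eq_C_mul, Finset.mul_sum, mul_assoc, mul_left_comm (C c)]

lemma eichlerKernel_eval (m : ℕ) (F : ℕ → ℍ → ℂ) (w : ℍ) (z : ℂ) :
    (eichlerKernel m F w).toPoly.eval z = ∑ i ∈ Finset.range (m + 1),
      (-1) ^ i * m.descFactorial i * (F (i + 1) w * (w - z) ^ (m - i)) := by
  have h : (eichlerKernel m F w).toPoly = ∑ i ∈ Finset.range (m + 1),
      Polynomial.C ((-1) ^ i * m.descFactorial i * F (i + 1) w) *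
        (Polynomial.C (w : ℂ) - Polynomial.X) ^ (m - i) := rfl
  simp [h, Polynomial.eval_finsetSum, mul_assoc]

lemma isPrimitive_eichlerKernel {F : ℕ → ℍ → ℂ} (hF : ∀ i, IsPrimitive (F (i + 1)) (F i)) (m : ℕ)
    (z : ℂ) :
    IsPrimitive (fun w => (eichlerKernel m F w).toPoly.eval z)
      (fun w => F 0 w * (w - z) ^ m) := by
  simp_rw [eichlerKernel_eval]
  have hterm := IsPrimitive.sum fun i (_ : i ∈ Finset.range (m + 1)) =>
    ((hF i).mul (isPrimitive_coe_sub_pow z (m - i))).const_mul ((-1) ^ i * m.descFactorial i)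
  convert! hterm using 1
  ext w
  let t : ℕ → ℂ := fun i => (-1) ^ i * m.descFactorial i * (F i w * (w - z) ^ (m - i))
  have htelescope (i : ℕ) : (-1) ^ i * m.descFactorial i * (F i w * (w - z) ^ (m - i) +
      F (i + 1) w * ((m - i : ℕ) * (w - z) ^ (m - i - 1))) = t i - t (i + 1) := by
    simp only [t, Nat.descFactorial_succ, Nat.cast_mul, Nat.sub_sub]
    ring
  simp only [htelescope, Finset.sum_range_sub']
  simp [t]

lemma eichlerKernel_eval_self (m : ℕ) (F : ℕ → ℍ → ℂ) (z : ℍ) :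
    (eichlerKernel m F z).toPoly.eval (z : ℂ) = (-1) ^ m * m.factorial * F (m + 1) z := by
  rw [eichlerKernel_eval, Finset.sum_range_succ, Finset.sum_eq_zero fun i hi => ?_]
  · simp [Nat.descFactorial_self]
  · rw [sub_self, zero_pow (Nat.sub_pos_of_lt (Finset.mem_range.mp hi)).ne', mul_zero, mul_zero]

lemma isPrimitive_eichlerKernel_smul {F : ℕ → ℍ → ℂ} (hF : ∀ i, IsPrimitive (F (i + 1)) (F i))
    {m : ℕ} {γ : SL(2, ℤ)}
    (hγ : ∀ z : ℍ, F 0 (γ • z) = ((γ 1 0 : ℂ) * z + γ 1 1) ^ (m + 2) * F 0 z) (z : ℍ) :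
    IsPrimitive (fun w => ((γ 1 0 : ℂ) * z + γ 1 1) ^ m *
        (eichlerKernel m F (γ • w)).toPoly.eval ((γ • z : ℍ) : ℂ))
      (fun w => F 0 w * (w - z) ^ m) := by
  convert! ((isPrimitive_eichlerKernel hF m (γ • z : ℍ)).comp_smul γ).const_mul
    (((γ 1 0 : ℂ) * z + γ 1 1) ^ m) using 1
  ext w
  have hw := factor_ne_zero γ w
  have hz := factor_ne_zero γ z
  rw [hγ, coe_smul_sub_coe_smul, div_pow, mul_pow, pow_add]
  generalize (γ 1 0 : ℂ) * w + γ 1 1 = jw at hw ⊢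
  generalize (γ 1 0 : ℂ) * z + γ 1 1 = jz at hz ⊢
  field_simp

/-! ### The Eichler cochains -/

/-- The cochain `γ ↦ ∫_i^{γ⁻¹ i} F₀(w) (w - X)^m dw`, where `F` is a sequence of iterated
primitives. -/
def eichlerCochain (m : ℕ) : (ℕ → ℍ → ℂ) →ₗ[ℂ] (SL(2, ℤ) → PolyLE ℂ m) :=
  LinearMap.pi fun γ => LinearMap.proj (γ⁻¹ • UpperHalfPlane.I) ∘ₗ eichlerKernel m -
    LinearMap.proj UpperHalfPlane.I ∘ₗ eichlerKernel m

lemma eichlerCochain_apply (m : ℕ) (F : ℕ → ℍ → ℂ) (γ : SL(2, ℤ)) :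
    eichlerCochain m F γ =
      eichlerKernel m F (γ⁻¹ • UpperHalfPlane.I) - eichlerKernel m F UpperHalfPlane.I := rfl

/-- The cochain obtained from `eichlerCochain m F` by moving the base point of the integral from
`i` to the cusp: it is the coboundary of a multiple of `F_{m+1}`, which need not be a polynomial. -/
def cuspCochain (m : ℕ) : (ℕ → ℍ → ℂ) →ₗ[ℂ] (SL(2, ℤ) → PolyLE ℂ m) :=
  eichlerCochain m - dZero ℂ m ∘ₗ LinearMap.proj UpperHalfPlane.I ∘ₗ eichlerKernel m

lemma eichlerCochain_sub_cuspCochain_mem_coboundaries (m : ℕ) (F : ℕ → ℍ → ℂ) :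
    eichlerCochain m F - cuspCochain m F ∈ coboundaries ℂ m :=
  ⟨eichlerKernel m F UpperHalfPlane.I, (sub_sub_cancel _ _).symm⟩

lemma eichlerCochain_eval_eq_dZeroFun {F : ℕ → ℍ → ℂ} {m : ℕ}
    (hF : ∀ i, IsPrimitive (F (i + 1)) (F i))
    (hmod : ∀ (γ : SL(2, ℤ)) (z : ℍ), F 0 (γ • z) = ((γ 1 0 : ℂ) * z + γ 1 1) ^ (m + 2) * F 0 z)
    (γ : SL(2, ℤ)) (z : ℍ) :
    (eichlerCochain m F γ).toPoly.eval (z : ℂ) =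
      dZeroFun m (fun z => (eichlerKernel m F UpperHalfPlane.I).toPoly.eval (z : ℂ) +
        (-1) ^ (m + 1) * m.factorial * F (m + 1) z) γ z := by
  have hdiff := (isPrimitive_eichlerKernel_smul hF (hmod γ) z).sub_eq_sub
    (isPrimitive_eichlerKernel hF m z) (γ⁻¹ • UpperHalfPlane.I) z
  simp only [smul_inv_smul, eichlerKernel_eval_self] at hdiff
  rw [eichlerCochain_apply, map_sub, Polynomial.eval_sub, dZeroFun]
  linear_combination -hdiff

lemma cuspCochain_eval_eq_dZeroFun {F : ℕ → ℍ → ℂ} {m : ℕ}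
    (hF : ∀ i, IsPrimitive (F (i + 1)) (F i))
    (hmod : ∀ (γ : SL(2, ℤ)) (z : ℍ), F 0 (γ • z) = ((γ 1 0 : ℂ) * z + γ 1 1) ^ (m + 2) * F 0 z)
    (γ : SL(2, ℤ)) (z : ℍ) :
    (cuspCochain m F γ).toPoly.eval (z : ℂ) =
      dZeroFun m (fun z => (-1) ^ (m + 1) * m.factorial * F (m + 1) z) γ z := by
  change Polynomial.eval (z : ℂ) (PolyLE.toPoly
    (eichlerCochain m F γ - dZero ℂ m (eichlerKernel m F UpperHalfPlane.I) γ)) = _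
  rw [map_sub, Polynomial.eval_sub, eichlerCochain_eval_eq_dZeroFun hF hmod, dZero_eval, dZeroFun,
    dZeroFun, dZeroFun]
  ring

/-! ### Integrals along vertical half-lines -/

lemma integrableOn_pow_mul_exp (m : ℕ) {r : ℝ} (hr : 0 < r) :
    IntegrableOn (fun t : ℝ => t ^ m * Real.exp (-(r * t))) (Set.Ioi 0) := by
  simpa [Real.rpow_natCast] using integrableOn_rpow_mul_exp_neg_mul_rpow
    (neg_one_lt_zero.trans_le m.cast_nonneg) zero_lt_one hr

lemma integral_pow_mul_exp (m : ℕ) {r : ℝ} (hr : 0 < r) :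
    ∫ t in Set.Ioi (0 : ℝ), t ^ m * Real.exp (-(r * t)) = m.factorial / r ^ (m + 1) := by
  have h := Real.integral_rpow_mul_exp_neg_mul_Ioi (a := m + 1) (by positivity) hr
  rw [add_sub_cancel_right, Real.Gamma_nat_eq_factorial, ← Nat.cast_add_one] at h
  simp_rw [Real.rpow_natCast] at h
  rw [h, one_div, inv_pow, inv_mul_eq_div]

/-- The integrand of `∫ g(w) (w - z)^m dw` along the half-line `w = z + s i t`, `t > 0`, which goes
up for `s = 1` and down for `s = -1`. -/
def verticalIntegrand (s : ℝ) (m : ℕ) (g : ℂ → ℂ) (z : ℂ) (t : ℝ) : ℂ :=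
  g (z + Complex.I * (s * t : ℝ)) * ((z + Complex.I * (s * t : ℝ)) - z) ^ m * (s * Complex.I)

lemma verticalIntegrand_qPow (s : ℝ) (m : ℕ) (n : ℤ) (z : ℂ) (t : ℝ) :
    verticalIntegrand s m (qPow n) z t = qPow n z * (s * Complex.I) ^ (m + 1) *
      (t ^ m * Real.exp (-(2 * Real.pi * (n * s) * t)) : ℝ) := by
  have hexp : qPow n (Complex.I * (s * t : ℝ)) =
      (Real.exp (-(2 * Real.pi * (n * s) * t)) : ℝ) := by
    rw [qPow, Complex.ofReal_exp]
    congr 1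
    push_cast
    linear_combination (2 * Real.pi * n * s * t : ℂ) * Complex.I_sq
  rw [verticalIntegrand, qPow_add_arg, hexp, add_sub_cancel_left]
  push_cast
  ring

section

variable {s : ℝ} {n : ℤ}

lemma integrableOn_verticalIntegrand_qPow (hn : 0 < n * s) (m : ℕ) (z : ℂ) :
    IntegrableOn (verticalIntegrand s m (qPow n) z) (Set.Ioi 0) := by
  simp_rw [funext (verticalIntegrand_qPow s m n z)]
  exact (integrableOn_pow_mul_exp m (mul_pos Real.two_pi_pos hn)).ofReal.const_mul _

lemma integral_verticalIntegrand_qPow (hn : 0 < n * s) (m : ℕ) (z : ℂ) :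
    ∫ t in Set.Ioi (0 : ℝ), verticalIntegrand s m (qPow n) z t =
      (-1) ^ (m + 1) * m.factorial * (qPow n z / (2 * Real.pi * Complex.I * n) ^ (m + 1)) := by
  have hs : (s : ℂ) ≠ 0 := by exact_mod_cast (right_ne_zero_of_mul hn.ne')
  have hbase : (s * Complex.I) / (2 * Real.pi * (n * s)) = -1 / (2 * Real.pi * Complex.I * n) := by
    rw [← mul_div_mul_left (-1 : ℂ) _ Complex.I_ne_zero, ← mul_div_mul_right (Complex.I * -1) _ hs,
      ← neg_div_neg_eq]
    congr 1
    · ring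
    · linear_combination (-2 * Real.pi * n * s : ℂ) * Complex.I_sq
  simp_rw [verticalIntegrand_qPow]
  rw [integral_const_mul, integral_complex_ofReal,
    integral_pow_mul_exp m (mul_pos Real.two_pi_pos hn)]
  push_cast
  rw [mul_div_assoc', mul_right_comm, mul_div_assoc, ← div_pow, hbase, div_pow]
  ring

lemma integral_norm_verticalIntegrand_qPow_le (hs : |s| = 1) (hn : 0 < n * s) (m : ℕ) (z : ℂ) :
    ∫ t in Set.Ioi (0 : ℝ), ‖verticalIntegrand s m (qPow n) z t‖ ≤ m.factorial * ‖qPow n z‖ := by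
  have hnorm : ∀ t ∈ Set.Ioi (0 : ℝ), ‖verticalIntegrand s m (qPow n) z t‖ =
      ‖qPow n z‖ * (t ^ m * Real.exp (-(2 * Real.pi * (n * s) * t))) := fun t ht => by
    have ht : 0 < t := ht
    rw [verticalIntegrand_qPow, norm_mul, norm_mul, norm_pow, norm_mul, Complex.norm_I,
      Complex.norm_real, Real.norm_eq_abs, hs, mul_one, one_pow, mul_one, Complex.norm_real,
      Real.norm_of_nonneg (by positivity)]
  have hrate : 1 ≤ 2 * Real.pi * (n * s) := by
    have h : 1 ≤ |(n : ℝ)| := by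
      exact_mod_cast Int.one_le_abs (by exact_mod_cast left_ne_zero_of_mul hn.ne')
    rw [← abs_of_pos hn, abs_mul, hs, mul_one]
    nlinarith [Real.two_le_pi]
  rw [setIntegral_congr_fun measurableSet_Ioi hnorm, integral_const_mul,
    integral_pow_mul_exp m (zero_lt_one.trans_le hrate), mul_comm]
  exact mul_le_mul_of_nonneg_right
    (div_le_self m.factorial.cast_nonneg (one_le_pow₀ hrate)) (norm_nonneg _)

end

lemma integral_verticalIntegrand {b : qConvergent} {s : ℝ} (hs : |s| = 1)
    (hb : ∀ n, b.1 n ≠ 0 → 0 < n * s) (m : ℕ) (z : ℍ) :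
    ∫ t in Set.Ioi (0 : ℝ), verticalIntegrand s m (fun w => ∑' n, b.1 n * qPow n w) z t =
      (-1) ^ (m + 1) * m.factorial * qSeries (primCoef (m + 1) b) z := by
  have hint (n : ℤ) : IntegrableOn (fun t => b.1 n * verticalIntegrand s m (qPow n) z t)
      (Set.Ioi 0) := by
    by_cases hn : b.1 n = 0
    · simp [hn]
    · exact (integrableOn_verticalIntegrand_qPow (hb n hn) m z).const_mul _
  have hnorm (n : ℤ) :
      ∫ t in Set.Ioi (0 : ℝ), ‖b.1 n * verticalIntegrand s m (qPow n) z t‖ ≤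
        m.factorial * ‖b.1 n * qPow n z‖ := by
    simp_rw [norm_mul (b.1 n), integral_const_mul]
    by_cases hn : b.1 n = 0
    · simp [hn]
    · rw [mul_left_comm]
      exact mul_le_mul_of_nonneg_left
        (integral_norm_verticalIntegrand_qPow_le hs (hb n hn) m z) (norm_nonneg _)
  have hterm (n : ℤ) : ∫ t in Set.Ioi (0 : ℝ), b.1 n * verticalIntegrand s m (qPow n) z t =
      (-1) ^ (m + 1) * m.factorial * ((primCoef (m + 1) b).1 n * qPow n z) := by
    rw [integral_const_mul]
    by_cases hn : b.1 n = 0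
    · simp [primCoef, hn]
    · have hn0 : n ≠ 0 := by
        rintro rfl
        simpa using hb 0 hn
      rw [integral_verticalIntegrand_qPow (hb n hn), primCoef_apply _ _ hn0]
      ring
  have hsum := hasSum_integral_of_summable_integral_norm hint
    (.of_nonneg_of_le (fun n => integral_nonneg fun t => norm_nonneg _) hnorm
      ((b.2 z).norm.mul_left _))
  simp_rw [hterm] at hsum
  rw [((hasSum_qSeries _ z).mul_left _).unique hsum]
  congr 1 with t
  simp_rw [verticalIntegrand, ← tsum_mul_right, mul_assoc]

/-- The part `∑_{n ∈ S} aₙ qⁿ` of a Laurent series in `q`. -/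
def qRestrict (S : Set ℤ) (a : qConvergent) : qConvergent :=
  ⟨S.indicator a.1, mem_qConvergent_of_norm_le a.2 fun n => norm_indicator_le_norm_self a.1 n⟩

lemma integralUp_decayingPart (k : ℕ) (a : qConvergent) (z : ℍ) :
    integralUp k (decayingPart (qSeries a)) z = (-1) ^ (k - 2 + 1) * (k - 2).factorial *
      qSeries (primCoef (k - 2 + 1) (qRestrict {n | 0 < n} a)) z := by
  rw [← integral_verticalIntegrand (s := 1) abs_one fun n hn => ?_]
  · simp [integralUp, verticalIntegrand, decayingPart, qRestrict, Set.indicator_apply,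
      fourierCoef_qSeries]
  · have hpos : 0 < n := Set.mem_of_indicator_ne_zero (s := {n : ℤ | 0 < n}) (f := a.1) hn
    rw [mul_one]
    exact_mod_cast hpos

lemma integralDown_principalPart (k : ℕ) (a : qConvergent) (z : ℍ) :
    integralDown k (principalPart (qSeries a)) z = (-1) ^ (k - 2 + 1) * (k - 2).factorial *
      qSeries (primCoef (k - 2 + 1) (qRestrict {n | n < 0} a)) z := by
  rw [← integral_verticalIntegrand (s := -1) (by simp) fun n hn => ?_]
  · simp [integralDown, verticalIntegrand, principalPart, qRestrict, Set.indicator_apply,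
      fourierCoef_qSeries, sub_eq_add_neg]
  · have hneg : n < 0 := Set.mem_of_indicator_ne_zero (s := {n : ℤ | n < 0}) (f := a.1) hn
    rw [mul_neg_one, neg_pos]
    exact_mod_cast hneg

lemma vPrime_qSeries (k : ℕ) (a : qConvergent) (z : ℍ) :
    vPrime k (qSeries a) z = (-1) ^ (k - 2 + 1) * (k - 2).factorial *
      qSeries (primCoef (k - 2 + 1) a) z := by
  have hsplit : primCoef (k - 2 + 1) (qRestrict {n | 0 < n} a) +
      primCoef (k - 2 + 1) (qRestrict {n | n < 0} a) = primCoef (k - 2 + 1) a := by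
    ext n
    rcases lt_trichotomy n 0 with hn | rfl | hn
    · simp [primCoef, qRestrict, Set.indicator_apply, hn, hn.not_gt]
    · simp [primCoef, qRestrict, Set.indicator_apply]
    · simp [primCoef, qRestrict, Set.indicator_apply, hn, hn.not_gt]
  rw [vPrime, integralUp_decayingPart, integralDown_principalPart, ← mul_add, ← Pi.add_apply,
    ← map_add, hsplit]

/-! ### The cocycles attached to a form -/

/-- The iterated primitives of a weakly holomorphic form, integrated termwise in `q`. -/
def formPrim (w : ℤ) : weakForms ℂ w →ₗ[ℂ] (ℕ → ℍ → ℂ) := iterPrim ∘ₗ qCoeffs w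

lemma formPrim_zero {w : ℤ} (f : weakForms ℂ w) : formPrim w f 0 = f :=
  (iterPrim_zero _).trans (qSeries_qCoeffs f)

lemma isPrimitive_formPrim {w : ℤ} (f : weakForms ℂ w) (r : ℕ) :
    IsPrimitive (formPrim w f (r + 1)) (formPrim w f r) := isPrimitive_iterPrim _ r

lemma formPrim_eq_qSeries {w : ℤ} {f : weakForms ℂ w} (hf : fourierCoef f 0 = 0) (r : ℕ) :
    formPrim w f r = qSeries (primCoef r (qCoeffs w f)) := by
  ext z
  change iterPrim _ r z = _
  rw [iterPrim_apply, qCoeffs_apply, hf, zero_mul, add_zero]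

section

variable {k : ℕ}

lemma formPrim_zero_smul (hk : 2 ≤ k) (f : weakForms ℂ k) (γ : SL(2, ℤ)) (z : ℍ) :
    formPrim k f 0 (γ • z) =
      ((γ 1 0 : ℂ) * z + γ 1 1) ^ (k - 2 + 2) * formPrim k f 0 z := by
  rw [formPrim_zero, f.2.1.modular, zpow_natCast, Nat.sub_add_cancel hk]

lemma isEichlerCocycle_eichlerCochain (f : weakForms ℂ k) :
    IsEichlerCocycle k f (eichlerCochain (k - 2) (formPrim k f)) := by
  intro γ z
  have hcont : Continuous fun w : ℍ => formPrim k f 0 w * ((w : ℂ) - z) ^ (k - 2) := by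
    rw [formPrim_zero]
    exact f.2.1.mdiff.continuous.mul ((UpperHalfPlane.continuous_coe.sub continuous_const).pow _)
  rw [eichlerCochain_apply, map_sub, Polynomial.eval_sub,
    ← (isPrimitive_eichlerKernel (isPrimitive_formPrim f) (k - 2) z).integral_lineMap hcont]
  refine intervalIntegral.integral_congr fun t ht => ?_
  rw [Set.uIcc_of_le zero_le_one] at ht
  have him := (convex_halfSpace_im_gt 0).lineMap_mem UpperHalfPlane.I.im_pos
    (γ⁻¹ • UpperHalfPlane.I).im_pos ht
  have hcoe := congrArg UpperHalfPlane.coe (ofComplex_apply_of_im_pos him)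
  simp only [← UpperHalfPlane.coe_I, Function.comp_apply, formPrim_zero, hcoe]

lemma eichlerCochain_mem_cocycles (hk : 2 ≤ k) (f : weakForms ℂ k) :
    eichlerCochain (k - 2) (formPrim k f) ∈ cocycles ℂ (k - 2) :=
  mem_cocycles_of_dZeroFun
    (eichlerCochain_eval_eq_dZeroFun (isPrimitive_formPrim f) (formPrim_zero_smul hk f))

lemma vPrime_eq_formPrim {f : weakForms ℂ k} (hf : fourierCoef f 0 = 0) :
    vPrime k f =
      fun z => (-1) ^ (k - 2 + 1) * (k - 2).factorial * formPrim k f (k - 2 + 1) z := by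
  ext z
  rw [formPrim_eq_qSeries hf, ← vPrime_qSeries, qSeries_qCoeffs]

lemma vPrime_T_smul {f : weakForms ℂ k} (hf : fourierCoef f 0 = 0) (z : ℍ) :
    vPrime k f (ModularGroup.T • z) = vPrime k f z := by
  simp only [vPrime_eq_formPrim hf, formPrim_eq_qSeries hf, qSeries_T_smul]

lemma isCuspCocycle_cuspCochain (hk : 2 ≤ k) {f : weakForms ℂ k} (hf : fourierCoef f 0 = 0) :
    IsCuspCocycle k f (cuspCochain (k - 2) (formPrim k f)) := by
  intro γ z
  rw [vPrime_eq_formPrim hf]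
  exact cuspCochain_eval_eq_dZeroFun (isPrimitive_formPrim f) (formPrim_zero_smul hk f) γ z

lemma cuspCochain_mem_parCocycles (hk : 2 ≤ k) {f : weakForms ℂ k} (hf : fourierCoef f 0 = 0) :
    cuspCochain (k - 2) (formPrim k f) ∈ parCocycles ℂ (k - 2) :=
  ⟨mem_cocycles_of_dZeroFun (isCuspCocycle_cuspCochain hk hf),
    mem_vanishAtT_of_dZeroFun (isCuspCocycle_cuspCochain hk hf) (vPrime_T_smul hf)⟩

lemma qCoeffs_iterD {w w' : ℤ} {f : weakForms ℂ w} {g : weakForms ℂ w'} {n : ℕ}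
    (hfg : f.1 = iterD n g) : qCoeffs w f = (eulerOp ^ n) (qCoeffs w' g) := by
  ext i
  rw [eulerOp_pow_apply, qCoeffs_apply, qCoeffs_apply, hfg, fourierCoef_iterD g.2.1]

lemma vPrime_iterD {f : weakForms ℂ k} (hf : fourierCoef f 0 = 0) {w : ℤ} {g : weakForms ℂ w}
    (hfg : f.1 = iterD (k - 2 + 1) g) (z : ℍ) :
    vPrime k f z = (-1) ^ (k - 2 + 1) * (k - 2).factorial *
      ((2 * Real.pi * Complex.I : ℂ) ^ (k - 2 + 1))⁻¹ * (g.1 z - fourierCoef g 0) := by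
  rw [congrFun (vPrime_eq_formPrim hf) z, mul_assoc _ (_ ^ _)⁻¹, formPrim_eq_qSeries hf,
    qCoeffs_iterD hfg, primCoef_eulerOp_pow, map_smul, Pi.smul_apply, smul_eq_mul,
    qSeries_primCoef_zero, qSeries_qCoeffs, qCoeffs_apply]

lemma cuspCochain_mem_coboundaries (hk : 2 ≤ k) {f : weakForms ℂ k}
    (hf : f.1 ∈ exactForms ℂ k) :
    cuspCochain (k - 2) (formPrim k f) ∈ coboundaries ℂ (k - 2) := by
  have hf₀ : fourierCoef f 0 = 0 := (exactForms_le ℂ hk hf).2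
  obtain ⟨g, hg, hfg⟩ := hf
  obtain ⟨c, hv⟩ : ∃ c : ℂ, ∀ z, vPrime k f z = c * (g z - fourierCoef g 0) :=
    ⟨_, vPrime_iterD hf₀ (g := ⟨g, hg⟩) (by rwa [show k - 2 + 1 = k - 1 by omega])⟩
  have hgmod (γ : SL(2, ℤ)) (z : ℍ) : ((γ 1 0 : ℂ) * z + γ 1 1) ^ (k - 2) * g (γ • z) = g z := by
    rw [hg.1.modular, ← zpow_natCast, ← mul_assoc, ← zpow_add₀ (factor_ne_zero γ z),
      Nat.cast_sub hk]
    simp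
  refine ⟨.ofPoly (Polynomial.C (-(c * fourierCoef g 0)))
    (Polynomial.degree_C_le.trans (by exact_mod_cast Nat.zero_le _)), ?_⟩
  refine funext fun γ => PolyLE.ext_eval fun z => ?_
  rw [dZero_eval, isCuspCocycle_cuspCochain hk hf₀, dZeroFun, dZeroFun, hv, hv]
  simp only [PolyLE.toPoly_ofPoly, Polynomial.eval_C]
  linear_combination -c * hgmod γ z

lemma eichlerCochain_mem_coboundaries (hk : 2 ≤ k) {f : weakForms ℂ k}
    (hf : f.1 ∈ exactForms ℂ k) :
    eichlerCochain (k - 2) (formPrim k f) ∈ coboundaries ℂ (k - 2) := by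
  rw [← sub_add_cancel (eichlerCochain _ _) (cuspCochain (k - 2) (formPrim k f))]
  exact add_mem (eichlerCochain_sub_cuspCochain_mem_coboundaries _ _)
    (cuspCochain_mem_coboundaries hk hf)

end

/-! ### Coordinates of cocycles over a subfield -/

lemma eventually_sum_coord_smul {ι R M : Type*} [CommSemiring R] [AddCommMonoid M] [Module R M]
    (b : Module.Basis ι R M) (x : M) :
    ∀ᶠ s : Finset ι in Filter.atTop, ∑ i ∈ s, b.coord i x • b i = x := by
  filter_upwards [Filter.eventually_ge_atTop (b.repr x).support] with s hs
  conv_rhs => rw [← b.linearCombination_repr x, Finsupp.linearCombination_apply,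
    Finsupp.sum_of_support_subset _ hs _ (by simp)]
  rfl

lemma liftBaseChange_bijective {ι R A M N : Type*} [CommRing R] [CommRing A] [Algebra R A]
    [AddCommGroup M] [Module R M] [AddCommGroup N] [Module R N] [Module A N] [IsScalarTower R A N]
    (b : Module.Basis ι R A) (φ : M →ₗ[R] N) (κ : ι → N →ₗ[R] M)
    (hκ : ∀ i a x, κ i (a • φ x) = b.coord i a • x)
    (hspan : ∀ y, ∃ s : Finset ι, ∑ i ∈ s, b i • φ (κ i y) = y) :
    Function.Bijective (φ.liftBaseChange A) := by
  constructor
  · rw [injective_iff_map_eq_zero]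
    intro x hx
    obtain ⟨c, rfl⟩ := TensorProduct.eq_repr_basis_left b x
    have hc (j : ι) : c j = 0 := by
      classical
      simpa only [Finsupp.sum, map_sum, LinearMap.liftBaseChange_tmul, hκ, Module.Basis.coord_apply,
        Module.Basis.repr_self, Finsupp.single_apply, ite_smul, one_smul, zero_smul, map_zero,
        Finset.sum_ite_eq', Finsupp.mem_support_iff, ne_eq, ite_not, ite_eq_left_iff,
        not_imp_self] using congrArg (κ j) hx
    simp [Finsupp.sum, hc]
  · intro y
    obtain ⟨s, hs⟩ := hspan y
    exact ⟨∑ i ∈ s, b i ⊗ₜ κ i y, by simpa using hs⟩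

/-- The map `Z / B → Z' / B'` induced on subquotients by a linear map `f` with `f(Z) ⊆ Z'` and
`f(B) ⊆ B'`, where `f` is only linear over a subring of the scalars of `Z` and `B`. -/
def subquotientMap {R A M N : Type*} [CommRing R] [CommRing A] [Algebra R A]
    [AddCommGroup M] [Module R M] [Module A M] [IsScalarTower R A M] [AddCommGroup N] [Module R N]
    (f : M →ₗ[R] N) {Z B : Submodule A M} {Z' B' : Submodule R N}
    (hZ : ∀ x ∈ Z, f x ∈ Z') (hB : ∀ x ∈ B, f x ∈ B') :
    (Z ⧸ B.submoduleOf Z) →ₗ[R] Z' ⧸ B'.submoduleOf Z' :=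
  Submodule.mapQ ((B.submoduleOf Z).restrictScalars R) _
    (f.restrict (p := Z.restrictScalars R) hZ) (fun x hx => hB x hx) ∘ₗ
    (Submodule.Quotient.restrictScalarsEquiv R (B.submoduleOf Z)).symm.toLinearMap

open Polynomial in
lemma polySlash_one {K : Type} [Field K] {m : ℕ} (p : PolyLE K m) : polySlash K m 1 p = p := by
  apply PolyLE.toPoly_injective
  rw [polySlash_toPoly]
  conv_rhs => rw [as_sum_range_C_mul_X_pow' (p := p.toPoly)
    (Nat.lt_succ_of_le (natDegree_le_of_degree_le p.degree_le))]
  simp [slashRaw]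

lemma eq_zero_of_mem_cocycles {K : Type} [Field K] {m : ℕ} {σ : SL(2, ℤ) → PolyLE K m}
    (hσ : σ ∈ cocycles K m) (hS : σ ModularGroup.S = 0) (hT : σ ModularGroup.T = 0) : σ = 0 := by
  rw [mem_cocycles_iff] at hσ
  have hone : σ 1 = 0 := by simpa [polySlash_one] using hσ 1 1
  ext1 γ
  have hγ : γ ∈ Subgroup.closure {ModularGroup.S, ModularGroup.T} := by
    simp [SpecialLinearGroup.SL2Z_generators]
  induction hγ using Subgroup.closure_induction with
  | mem γ hγ =>
    rcases hγ with rfl | rfl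
    · exact hS
    · exact hT
  | one => exact hone
  | mul g₂ g₁ _ _ h₂ h₁ => simp [hσ, h₂, h₁]
  | inv γ _ hγ => simpa [hone, hγ] using (hσ γ⁻¹ γ).symm

section Coordinates

variable {K : Type} [Field K] [Algebra K ℂ] {m : ℕ}

/-- The map `P_m(ℂ) → P_m(K)` applying a `K`-linear functional to the coefficients. -/
def polyCoord (ℓ : ℂ →ₗ[K] K) : PolyLE ℂ m →ₗ[K] PolyLE K m where
  toFun p := .ofPoly (∑ i ∈ Finset.range (m + 1), Polynomial.monomial i (ℓ (p.toPoly.coeff i))) <|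
    (Polynomial.degree_sum_le _ _).trans <| Finset.sup_le fun i hi =>
      (Polynomial.degree_monomial_le i _).trans <| by
        exact_mod_cast Finset.mem_range_succ_iff.mp hi
  map_add' p q := by
    apply PolyLE.toPoly_injective
    simp [PolyLE.toPoly_ofPoly, Finset.sum_add_distrib]
  map_smul' c p := by
    apply PolyLE.toPoly_injective
    simp [PolyLE.toPoly_ofPoly, Finset.smul_sum, Polynomial.smul_monomial]

lemma polyCoord_coeff (ℓ : ℂ →ₗ[K] K) (p : PolyLE ℂ m) (i : ℕ) :
    (polyCoord ℓ p).toPoly.coeff i = ℓ (p.toPoly.coeff i) := by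
  have h : (polyCoord ℓ p).toPoly =
    ∑ j ∈ Finset.range (m + 1), Polynomial.monomial j (ℓ (p.toPoly.coeff j)) := rfl
  rw [h, Polynomial.finsetSum_coeff]
  simp only [Polynomial.coeff_monomial, Finset.sum_ite_eq', Finset.mem_range, ite_eq_left_iff]
  intro hi
  rw [Polynomial.coeff_eq_zero_of_degree_lt (p.degree_le.trans_lt (by
    exact_mod_cast not_lt.mp hi)), map_zero]

lemma polyCoord_smul_polyExt (ℓ : ℂ →ₗ[K] K) (c : ℂ) (p : PolyLE K m) :
    polyCoord ℓ (c • polyExt K m p) = ℓ c • p := by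
  apply PolyLE.toPoly_injective
  ext i
  rw [polyCoord_coeff, PolyLE.toPoly_smul, PolyLE.toPoly_smul, polyExt_toPoly,
    Polynomial.coeff_smul, Polynomial.coeff_smul, Polynomial.coeff_map, smul_eq_mul, mul_comm,
    ← Algebra.smul_def, map_smul, smul_eq_mul, smul_eq_mul, mul_comm]

lemma eventually_sum_smul_polyExt_polyCoord {ι : Type*} (b : Module.Basis ι K ℂ)
    (p : PolyLE ℂ m) :
    ∀ᶠ s : Finset ι in Filter.atTop,
      ∑ i ∈ s, b i • polyExt K m (polyCoord (b.coord i) p) = p := by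
  have hcoeff := (Filter.eventually_all_finset p.toPoly.support).mpr fun n _ =>
    eventually_sum_coord_smul b (p.toPoly.coeff n)
  filter_upwards [hcoeff] with s hs
  apply PolyLE.toPoly_injective
  ext n
  simp only [map_sum, map_smul, Polynomial.finsetSum_coeff, Polynomial.coeff_smul, polyExt_toPoly,
    Polynomial.coeff_map, polyCoord_coeff, smul_eq_mul]
  by_cases hn : n ∈ p.toPoly.support
  · conv_rhs => rw [← hs n hn]
    exact Finset.sum_congr rfl fun i _ => by rw [Algebra.smul_def, mul_comm]
  · simp [Polynomial.notMem_support_iff.mp hn]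

lemma polyCoord_slash (ℓ : ℂ →ₗ[K] K) (γ : SL(2, ℤ)) (p : PolyLE ℂ m) :
    polyCoord ℓ (polySlash ℂ m γ p) = polySlash K m γ (polyCoord ℓ p) := by
  obtain ⟨s, hs⟩ :=
    (eventually_sum_smul_polyExt_polyCoord (Module.Basis.ofVectorSpace K ℂ) p).exists
  rw [← hs]
  simp only [map_sum, map_smul, ← polyExt_slash, polyCoord_smul_polyExt]

/-- The map `C¹(Γ, P_m(ℂ)) → C¹(Γ, P_m(K))` applying a `K`-linear functional to the
coefficients. -/
def cochainCoord (ℓ : ℂ →ₗ[K] K) : (SL(2, ℤ) → PolyLE ℂ m) →ₗ[K] (SL(2, ℤ) → PolyLE K m) :=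
  LinearMap.pi fun γ => polyCoord ℓ ∘ₗ LinearMap.proj γ

lemma cochainCoord_smul_cochainExt (ℓ : ℂ →ₗ[K] K) (c : ℂ) (σ : SL(2, ℤ) → PolyLE K m) :
    cochainCoord ℓ (c • cochainExt K m σ) = ℓ c • σ :=
  funext fun γ => polyCoord_smul_polyExt ℓ c (σ γ)

lemma cochainCoord_mem_cocycles (ℓ : ℂ →ₗ[K] K) {σ : SL(2, ℤ) → PolyLE ℂ m}
    (hσ : σ ∈ cocycles ℂ m) : cochainCoord ℓ σ ∈ cocycles K m := by
  rw [mem_cocycles_iff] at hσ ⊢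
  intro g₁ g₂
  simp [cochainCoord, hσ, polyCoord_slash]

lemma cochainCoord_mem_coboundaries (ℓ : ℂ →ₗ[K] K) {σ : SL(2, ℤ) → PolyLE ℂ m}
    (hσ : σ ∈ coboundaries ℂ m) : cochainCoord ℓ σ ∈ coboundaries K m := by
  obtain ⟨p, rfl⟩ := hσ
  refine ⟨polyCoord ℓ p, ?_⟩
  ext1 γ
  simp [dZero, cochainCoord, polyCoord_slash]

lemma cochainCoord_mem_vanishAtT (ℓ : ℂ →ₗ[K] K) {σ : SL(2, ℤ) → PolyLE ℂ m}
    (hσ : σ ∈ vanishAtT ℂ m) : cochainCoord ℓ σ ∈ vanishAtT K m := by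
  simp only [vanishAtT, LinearMap.mem_ker, LinearMap.proj_apply] at hσ ⊢
  simp [cochainCoord, hσ]

lemma exists_sum_smul_cochainExt_cochainCoord {ι : Type*} (b : Module.Basis ι K ℂ)
    {σ : SL(2, ℤ) → PolyLE ℂ m} (hσ : σ ∈ cocycles ℂ m) :
    ∃ s : Finset ι, ∑ i ∈ s, b i • cochainExt K m (cochainCoord (b.coord i) σ) = σ := by
  obtain ⟨s, hS, hT⟩ := ((eventually_sum_smul_polyExt_polyCoord b (σ ModularGroup.S)).and
    (eventually_sum_smul_polyExt_polyCoord b (σ ModularGroup.T))).exists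
  refine ⟨s, sub_eq_zero.mp (eq_zero_of_mem_cocycles (sub_mem (sum_mem fun i _ => ?_) hσ) ?_ ?_)⟩
  · exact Submodule.smul_mem _ _ (cochainExt_cocycles K m (cochainCoord_mem_cocycles _ hσ))
  · simpa [cochainExt, cochainCoord, sub_eq_zero] using hS
  · simpa [cochainExt, cochainCoord, sub_eq_zero] using hT

lemma compareH_bijective : Function.Bijective (compareH K m) := by
  let b := Module.Basis.ofVectorSpace K ℂ
  refine liftBaseChange_bijective b _ (fun i => subquotientMap (cochainCoord (b.coord i))
    (fun _ => cochainCoord_mem_cocycles _) (fun _ => cochainCoord_mem_coboundaries _)) ?_ ?_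
  · rintro i c ⟨σ⟩
    exact congrArg Submodule.Quotient.mk (Subtype.ext (cochainCoord_smul_cochainExt _ c σ.1))
  · rintro ⟨σ⟩
    obtain ⟨s, hs⟩ := exists_sum_smul_cochainExt_cochainCoord b σ.2
    exact ⟨s, (map_sum (Submodule.mkQ _) _ _).symm.trans <| congrArg Submodule.Quotient.mk <|
      Subtype.ext <| (Submodule.coe_sum _ _ _).trans hs⟩

lemma compareHPar_bijective : Function.Bijective (compareHPar K m) := by
  let b := Module.Basis.ofVectorSpace K ℂ
  refine liftBaseChange_bijective b _ (fun i => subquotientMap (cochainCoord (b.coord i))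
    (fun _ h => ⟨cochainCoord_mem_cocycles _ h.1, cochainCoord_mem_vanishAtT _ h.2⟩)
    (fun _ h => ⟨cochainCoord_mem_coboundaries _ h.1, cochainCoord_mem_vanishAtT _ h.2⟩)) ?_ ?_
  · rintro i c ⟨σ⟩
    exact congrArg Submodule.Quotient.mk (Subtype.ext (cochainCoord_smul_cochainExt _ c σ.1))
  · rintro ⟨σ⟩
    obtain ⟨s, hs⟩ := exists_sum_smul_cochainExt_cochainCoord b σ.2.1
    exact ⟨s, (map_sum (Submodule.mkQ _) _ _).symm.trans <| congrArg Submodule.Quotient.mk <|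
      Subtype.ext <| (Submodule.coe_sum _ _ _).trans hs⟩

end Coordinates

/-! ### The maps on classes -/

section Complex

variable {k : ℕ} (hk : 2 ≤ k)

/-- The map `f ↦ φ(f)` from `M_k^!` to cocycles. -/
def eichlerMap : weakForms ℂ k →ₗ[ℂ] cocycles ℂ (k - 2) :=
  (eichlerCochain (k - 2) ∘ₗ formPrim k).codRestrict _ (eichlerCochain_mem_cocycles hk)

/-- The map `f ↦ φ'(f)` from `S_k^!` to parabolic cocycles. -/
def cuspMap : weakCuspForms ℂ k →ₗ[ℂ] parCocycles ℂ (k - 2) :=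
  (cuspCochain (k - 2) ∘ₗ formPrim k ∘ₗ Submodule.inclusion (weakCuspForms_le ℂ k)).codRestrict _
    fun f => cuspCochain_mem_parCocycles hk f.2.2

lemma isEichlerCocycle_eichlerMap (f : weakForms ℂ k) : IsEichlerCocycle k f (eichlerMap hk f) :=
  isEichlerCocycle_eichlerCochain f

lemma isCuspCocycle_cuspMap (f : weakCuspForms ℂ k) : IsCuspCocycle k f (cuspMap hk f) :=
  isCuspCocycle_cuspCochain hk (f := Submodule.inclusion (weakCuspForms_le ℂ k) f) f.2.2

/-- The map `[φ]` on classes. -/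
def eichlerClassMap : FormClasses ℂ k →ₗ[ℂ] HOne ℂ (k - 2) :=
  Submodule.mapQ _ _ (eichlerMap hk) fun _ hf => eichlerCochain_mem_coboundaries hk hf

/-- The map `[φ']` on classes. -/
def cuspClassMap : CuspFormClasses ℂ k →ₗ[ℂ] HOnePar ℂ (k - 2) :=
  Submodule.mapQ _ _ (cuspMap hk) fun f hf =>
    ⟨cuspCochain_mem_coboundaries hk (f := Submodule.inclusion (weakCuspForms_le ℂ k) f) hf,
      (cuspMap hk f).2.2⟩

lemma natJ_comp_cuspClassMap :
    natJ ℂ (k - 2) ∘ₗ cuspClassMap hk = eichlerClassMap hk ∘ₗ natI ℂ k :=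
  Submodule.linearMap_qext _ <| LinearMap.ext fun _ => Eq.symm <| (Submodule.Quotient.eq _).mpr <|
    eichlerCochain_sub_cuspCochain_mem_coboundaries _ _

end Complex

lemma natI_injective (K : Type) [Field K] [Algebra K ℂ] (k : ℕ) :
    Function.Injective (natI K k) := by
  rw [injective_iff_map_eq_zero]
  rintro ⟨f⟩ hf
  exact (Submodule.Quotient.mk_eq_zero _).mpr ((Submodule.Quotient.mk_eq_zero _).mp hf :)

lemma natJ_injective (K : Type) [Field K] (m : ℕ) : Function.Injective (natJ K m) := by
  rw [injective_iff_map_eq_zero]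
  rintro ⟨σ⟩ hσ
  exact (Submodule.Quotient.mk_eq_zero _).mpr ⟨((Submodule.Quotient.mk_eq_zero _).mp hσ :), σ.2.2⟩

section Rational

variable (K : Type) [Field K] [Algebra K ℂ] (k : ℕ)

lemma weakForms_le_complex (w : ℤ) : weakForms K w ≤ (weakForms ℂ w).restrictScalars K :=
  fun _ hf => hf.1.mem_weakForms

lemma weakCuspForms_le_complex (w : ℤ) :
    weakCuspForms K w ≤ (weakCuspForms ℂ w).restrictScalars K :=
  fun _ hf => ⟨hf.1.1.mem_weakForms, hf.2⟩

lemma exactForms_le_complex : exactForms K k ≤ (exactForms ℂ k).restrictScalars K := by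
  rintro _ ⟨g, hg, rfl⟩
  exact ⟨g, hg.1.mem_weakForms, rfl⟩

/-- The natural map `ℂ ⊗ (M_{k,K}^! / D^{k-1} M_{2-k,K}^!) → M_k^! / D^{k-1} M_{2-k}^!`. -/
def compareForms : ℂ ⊗[K] FormClasses K k →ₗ[ℂ] FormClasses ℂ k :=
  LinearMap.liftBaseChange ℂ <| Submodule.liftQ _
    ((Submodule.mkQ ((exactForms ℂ k).submoduleOf (weakForms ℂ k))).restrictScalars K ∘ₗ
      Submodule.inclusion (weakForms_le_complex K k))
    fun _ hf => (Submodule.Quotient.mk_eq_zero _).mpr (exactForms_le_complex K k hf)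

/-- The natural map `ℂ ⊗ (S_{k,K}^! / D^{k-1} M_{2-k,K}^!) → S_k^! / D^{k-1} M_{2-k}^!`. -/
def compareCuspForms : ℂ ⊗[K] CuspFormClasses K k →ₗ[ℂ] CuspFormClasses ℂ k :=
  LinearMap.liftBaseChange ℂ <| Submodule.liftQ _
    ((Submodule.mkQ ((exactForms ℂ k).submoduleOf (weakCuspForms ℂ k))).restrictScalars K ∘ₗ
      Submodule.inclusion (weakCuspForms_le_complex K k))
    fun _ hf => (Submodule.Quotient.mk_eq_zero _).mpr (exactForms_le_complex K k hf)

lemma compareForms_one_tmul_formClass (f : weakForms K k) :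
    compareForms K k (1 ⊗ₜ formClass K k f) = formClass ℂ k ⟨f, weakForms_le_complex K k f.2⟩ :=
  one_smul ℂ (formClass ℂ k _)

lemma compareCuspForms_one_tmul_cuspFormClass (f : weakCuspForms K k) :
    compareCuspForms K k (1 ⊗ₜ cuspFormClass K k f) =
      cuspFormClass ℂ k ⟨f, weakCuspForms_le_complex K k f.2⟩ :=
  one_smul ℂ (cuspFormClass ℂ k _)

lemma natI_comp_compareCuspForms :
    natI ℂ k ∘ₗ compareCuspForms K k = compareForms K k ∘ₗ (natI K k).baseChange ℂ :=
  TensorProduct.AlgebraTensorModule.ext <| by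
    rintro c ⟨f⟩
    rfl

lemma natJ_comp_compareHPar (m : ℕ) :
    natJ ℂ m ∘ₗ compareHPar K m = compareH K m ∘ₗ (natJ K m).baseChange ℂ :=
  TensorProduct.AlgebraTensorModule.ext <| by
    rintro c ⟨σ⟩
    rfl

variable {k} (hk : 2 ≤ k)

/-- The map `[φ]` in terms of classes with coefficients in `K`. -/
def eichlerClassMapOver : ℂ ⊗[K] FormClasses K k →ₗ[ℂ] ℂ ⊗[K] HOne K (k - 2) :=
  (LinearEquiv.ofBijective _ (compareH_bijective (K := K) (m := k - 2))).symm.toLinearMap ∘ₗ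
    eichlerClassMap hk ∘ₗ compareForms K k

/-- The map `[φ']` in terms of classes with coefficients in `K`. -/
def cuspClassMapOver : ℂ ⊗[K] CuspFormClasses K k →ₗ[ℂ] ℂ ⊗[K] HOnePar K (k - 2) :=
  (LinearEquiv.ofBijective _ (compareHPar_bijective (K := K) (m := k - 2))).symm.toLinearMap ∘ₗ
    cuspClassMap hk ∘ₗ compareCuspForms K k

lemma compareH_eichlerClassMapOver (x : ℂ ⊗[K] FormClasses K k) :
    compareH K (k - 2) (eichlerClassMapOver K hk x) = eichlerClassMap hk (compareForms K k x) :=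
  (LinearEquiv.ofBijective _ compareH_bijective).apply_symm_apply _

lemma compareHPar_cuspClassMapOver (x : ℂ ⊗[K] CuspFormClasses K k) :
    compareHPar K (k - 2) (cuspClassMapOver K hk x) = cuspClassMap hk (compareCuspForms K k x) :=
  (LinearEquiv.ofBijective _ compareHPar_bijective).apply_symm_apply _

lemma compareH_eichlerClassMapOver_formClass (f : weakForms K k) :
    compareH K (k - 2) (eichlerClassMapOver K hk (1 ⊗ₜ formClass K k f)) =
      cocycleClass ℂ (k - 2) (eichlerMap hk ⟨f, weakForms_le_complex K k f.2⟩) := by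
  rw [compareH_eichlerClassMapOver, compareForms_one_tmul_formClass]
  rfl

lemma compareHPar_cuspClassMapOver_cuspFormClass (f : weakCuspForms K k) :
    compareHPar K (k - 2) (cuspClassMapOver K hk (1 ⊗ₜ cuspFormClass K k f)) =
      parCocycleClass ℂ (k - 2) (cuspMap hk ⟨f, weakCuspForms_le_complex K k f.2⟩) := by
  rw [compareHPar_cuspClassMapOver, compareCuspForms_one_tmul_cuspFormClass]
  rfl

lemma natJ_comp_cuspClassMapOver :
    (natJ K (k - 2)).baseChange ℂ ∘ₗ cuspClassMapOver K hk =
      eichlerClassMapOver K hk ∘ₗ (natI K k).baseChange ℂ := by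
  refine LinearMap.ext fun x => compareH_bijective.1 ?_
  calc compareH K (k - 2) ((natJ K (k - 2)).baseChange ℂ (cuspClassMapOver K hk x))
      = natJ ℂ (k - 2) (compareHPar K (k - 2) (cuspClassMapOver K hk x)) :=
        (LinearMap.congr_fun (natJ_comp_compareHPar K (k - 2)) _).symm
    _ = natJ ℂ (k - 2) (cuspClassMap hk (compareCuspForms K k x)) := by
        rw [compareHPar_cuspClassMapOver]
    _ = eichlerClassMap hk (natI ℂ k (compareCuspForms K k x)) :=
        LinearMap.congr_fun (natJ_comp_cuspClassMap hk) _
    _ = eichlerClassMap hk (compareForms K k ((natI K k).baseChange ℂ x)) :=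
        congrArg _ (LinearMap.congr_fun (natI_comp_compareCuspForms K k) x)
    _ = compareH K (k - 2) (eichlerClassMapOver K hk ((natI K k).baseChange ℂ x)) :=
        (compareH_eichlerClassMapOver K hk _).symm

end Rational

end

theorem proposition6p2_general (K : Type) [Field K] [Algebra K ℂ] (k : ℕ) (hk : 2 ≤ k) :
    (exactForms ℂ k ≤ weakCuspForms ℂ k ∧ exactForms K k ≤ weakCuspForms K k) ∧
    (∃ (Φ : FormClasses ℂ k →ₗ[ℂ] HOne ℂ (k - 2))
       (Φ' : CuspFormClasses ℂ k →ₗ[ℂ] HOnePar ℂ (k - 2)),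
      (∀ f : weakForms ℂ k, ∃ σ : cocycles ℂ (k - 2),
        IsEichlerCocycle k f σ ∧ Φ (formClass ℂ k f) = cocycleClass ℂ (k - 2) σ) ∧
      (∀ f : weakCuspForms ℂ k, ∃ σ : parCocycles ℂ (k - 2),
        IsCuspCocycle k f σ ∧ Φ' (cuspFormClass ℂ k f) = parCocycleClass ℂ (k - 2) σ) ∧
      Function.Injective (natI ℂ k) ∧ Function.Injective (natJ ℂ (k - 2)) ∧
      natJ ℂ (k - 2) ∘ₗ Φ' = Φ ∘ₗ natI ℂ k) ∧
    (Function.Bijective (compareH K (k - 2)) ∧ Function.Bijective (compareHPar K (k - 2)) ∧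
     ∃ (Φ : ℂ ⊗[K] FormClasses K k →ₗ[ℂ] ℂ ⊗[K] HOne K (k - 2))
       (Φ' : ℂ ⊗[K] CuspFormClasses K k →ₗ[ℂ] ℂ ⊗[K] HOnePar K (k - 2)),
      (∀ f : weakForms K k, ∃ σ : cocycles ℂ (k - 2), IsEichlerCocycle k f σ ∧
        compareH K (k - 2) (Φ (1 ⊗ₜ formClass K k f)) = cocycleClass ℂ (k - 2) σ) ∧
      (∀ f : weakCuspForms K k, ∃ σ : parCocycles ℂ (k - 2), IsCuspCocycle k f σ ∧
        compareHPar K (k - 2) (Φ' (1 ⊗ₜ cuspFormClass K k f)) = parCocycleClass ℂ (k - 2) σ) ∧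
      Function.Injective ((natI K k).baseChange ℂ) ∧
      Function.Injective ((natJ K (k - 2)).baseChange ℂ) ∧
      (natJ K (k - 2)).baseChange ℂ ∘ₗ Φ' = Φ ∘ₗ (natI K k).baseChange ℂ) :=
  ⟨⟨exactForms_le ℂ hk, exactForms_le K hk⟩,
    ⟨eichlerClassMap hk, cuspClassMap hk,
      fun f => ⟨eichlerMap hk f, isEichlerCocycle_eichlerMap hk f, rfl⟩,
      fun f => ⟨cuspMap hk f, isCuspCocycle_cuspMap hk f, rfl⟩,
      natI_injective ℂ k, natJ_injective ℂ (k - 2), natJ_comp_cuspClassMap hk⟩,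
    compareH_bijective, compareHPar_bijective, eichlerClassMapOver K hk, cuspClassMapOver K hk,
    fun f => ⟨_, isEichlerCocycle_eichlerMap hk ⟨f, weakForms_le_complex K k f.2⟩,
      compareH_eichlerClassMapOver_formClass K hk f⟩,
    fun f => ⟨_, isCuspCocycle_cuspMap hk ⟨f, weakCuspForms_le_complex K k f.2⟩,
      compareHPar_cuspClassMapOver_cuspFormClass K hk f⟩,
    Module.Flat.lTensor_preserves_injective_linearMap _ (natI_injective K k),
    Module.Flat.lTensor_preserves_injective_linearMap _ (natJ_injective K (k - 2)),
    natJ_comp_cuspClassMapOver K hk⟩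

theorem proposition6p2 (k : ℕ) (hk : 2 ≤ k) :
    -- the quotients make sense: `D^{k-1} M_{2-k}^! ⊆ S_k^!`, over `ℂ` and over `ℚ`
    (exactForms ℂ k ≤ weakCuspForms ℂ k ∧ exactForms ℚ k ≤ weakCuspForms ℚ k) ∧
    -- complex coefficients
    (∃ (Φ : FormClasses ℂ k →ₗ[ℂ] HOne ℂ (k - 2))
       (Φ' : CuspFormClasses ℂ k →ₗ[ℂ] HOnePar ℂ (k - 2)),
      (∀ f : weakForms ℂ k, ∃ σ : cocycles ℂ (k - 2),
        IsEichlerCocycle k f σ ∧ Φ (formClass ℂ k f) = cocycleClass ℂ (k - 2) σ) ∧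
      (∀ f : weakCuspForms ℂ k, ∃ σ : parCocycles ℂ (k - 2),
        IsCuspCocycle k f σ ∧ Φ' (cuspFormClass ℂ k f) = parCocycleClass ℂ (k - 2) σ) ∧
      Function.Injective (natI ℂ k) ∧ Function.Injective (natJ ℂ (k - 2)) ∧
      natJ ℂ (k - 2) ∘ₗ Φ' = Φ ∘ₗ natI ℂ k) ∧
    -- rational structures, tensored with `ℂ`
    (Function.Bijective (compareH ℚ (k - 2)) ∧ Function.Bijective (compareHPar ℚ (k - 2)) ∧
     ∃ (Φ : ℂ ⊗[ℚ] FormClasses ℚ k →ₗ[ℂ] ℂ ⊗[ℚ] HOne ℚ (k - 2))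
       (Φ' : ℂ ⊗[ℚ] CuspFormClasses ℚ k →ₗ[ℂ] ℂ ⊗[ℚ] HOnePar ℚ (k - 2)),
      (∀ f : weakForms ℚ k, ∃ σ : cocycles ℂ (k - 2), IsEichlerCocycle k f σ ∧
        compareH ℚ (k - 2) (Φ (1 ⊗ₜ formClass ℚ k f)) = cocycleClass ℂ (k - 2) σ) ∧
      (∀ f : weakCuspForms ℚ k, ∃ σ : parCocycles ℂ (k - 2), IsCuspCocycle k f σ ∧
        compareHPar ℚ (k - 2) (Φ' (1 ⊗ₜ cuspFormClass ℚ k f)) = parCocycleClass ℂ (k - 2) σ) ∧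
      Function.Injective ((natI ℚ k).baseChange ℂ) ∧
      Function.Injective ((natJ ℚ (k - 2)).baseChange ℂ) ∧
      (natJ ℚ (k - 2)).baseChange ℂ ∘ₗ Φ' = Φ ∘ₗ (natI ℚ k).baseChange ℂ) :=
  proposition6p2_general ℚ k hk
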